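/- All graphs are finite and simple. A graph is planar if it can be drawn in the Euclidean plane so that vertices are distinct points, edges are (polygonal) simple arcs joining their ends and containing no other vertices, and two edges meet only in common ends. It is $2$-connected if it has at least three vertices, is connected, and remains connected after deleting any one vertex. Let $d(v)$ denote the degree of a vertex $v$ in $G$, let $\Delta$ be the maximum degree of $G$, and let $n_k(v)$ (respectively $n_{k^-}(v)$) denote the number of neighbours of $v$ of degree exactly $k$ (respectively at most $k$). **Lemma 1.** Let $G$ be a $2$-connected planar graph with $\Delta\ge 5$. Then $G$ contains at least one of the following configurations. (A1) A path $uvw$ with $d(v)=2$ and $d(u)\le 9$. (A2) A vertex $u$ with $n_2(u)\ge 1$ and $n_{8^-}(u)\ge d(u)-8$ such that at least one of the following holds: (A2.1) $n_{8^-}(u)\ge d(u)-7$; (A2.2) $n_{8^-}(u)=d(u)-8$ and $n_2(u)\ge d(u)-9$. (A3) A vertex $u$ with $d(u)=3$ adjacent to a vertex $v$ such that at least one of the following holds: (A3.1) $d(v)\le 8$; (A3.2) $d(v)=9$ and there is a vertex $u_2$ with $uu_2, vu_2\in E(G)$; (A3.3) $d(v)=10$, $n_{5^-}(v)\ge 5$,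 and there are two distinct vertices $u_1,u_2$ with $uu_i, vu_i\in E(G)$ for $i=1,2$. (A4) A vertex $v$ whose neighbours can be labelled $u=v_1,v_2,\dots,v_{d(v)}$ with $d(u)\le d(v_2)\le\cdots\le d(v_{d(v)})$ such that at least one of the following holds: (A4.1) $d(v)=4$, $4\le d(u)\le 7$, and $d(u)+d(v_2)\le 17$; (A4.2) $d(v)=5$, and either $4\le d(u)\le 6$ and $d(u)+d(v_2)+d(v_3)\le 18$, or $d(u)=d(v_2)=6$, $d(v_3)=d(v_4)=d(v_5)=7$ and $uv_5\in E(G)$. -/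

import Mathlib

namespace SimpleGraph

/-- The Euclidean plane. -/
abbrev Plane : Type := EuclideanSpace ℝ (Fin 2)

/-- `S` is a (polygonal) arc joining the points `a` and `b`: the union of finitely many, and at
least one, nondegenerate straight line segments `[p 0, p 1], [p 1, p 2], …, [p (n-1), p n]` with
`p 0 = a` and `p n = b`, where consecutive segments meet only in their common end and all other
pairs of segments are disjoint. -/
def IsArc (a b : Plane) (S : Set Plane) : Prop :=
  ∃ (n : ℕ) (p : ℕ → Plane),
    0 < n ∧ p 0 = a ∧ p n = b ∧
    (∀ i, i < n → p i ≠ p (i + 1)) ∧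
    (∀ i, i + 1 < n →
      segment ℝ (p i) (p (i + 1)) ∩ segment ℝ (p (i + 1)) (p (i + 2)) = {p (i + 1)}) ∧
    (∀ i j, i + 1 < j → j < n →
      Disjoint (segment ℝ (p i) (p (i + 1))) (segment ℝ (p j) (p (j + 1)))) ∧
    S = ⋃ i ∈ Set.Iio n, segment ℝ (p i) (p (i + 1))

/-- A crossing-free drawing of `G` in the plane: distinct vertices are distinct points, an edge
`uv` is an arc joining the points `u` and `v`, an edge contains no vertices other than its ends,
and two distinct edges meet only in common ends. -/
structure PlaneDrawing {V : Type*} (G : SimpleGraph V) where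
  /-- the point that represents a vertex -/
  pos : V → Plane
  /-- the arc that represents an edge (the values at non-edges are irrelevant) -/
  arc : Sym2 V → Set Plane
  pos_injective : Function.Injective pos
  isArc : ∀ u v, G.Adj u v → IsArc (pos u) (pos v) (arc s(u, v))
  vertex_on_arc : ∀ e ∈ G.edgeSet, ∀ w, pos w ∈ arc e → w ∈ e
  arc_inter_arc : ∀ e ∈ G.edgeSet, ∀ f ∈ G.edgeSet, e ≠ f →
    ∀ x ∈ arc e ∩ arc f, ∃ w, w ∈ e ∧ w ∈ f ∧ x = pos w

/-- A graph is planar if it can be drawn in the plane without crossings. -/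
def IsPlanar {V : Type*} (G : SimpleGraph V) : Prop :=
  Nonempty (PlaneDrawing G)

/-- A graph is 2-connected if it has more than two vertices, is connected, and stays connected
when any single vertex is deleted. -/
def IsTwoConnected {V : Type*} [Fintype V] (G : SimpleGraph V) : Prop :=
  2 < Fintype.card V ∧ G.Connected ∧ ∀ v : V, (G.induce {w | w ≠ v}).Connected

section Configurations

variable {V : Type*} [Fintype V] (G : SimpleGraph V) [DecidableRel G.Adj]

/-- `n_k(v)`: the number of neighbours of `v` of degree exactly `k`. -/
def numNbrs (k : ℕ) (v : V) : ℕ :=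
  ((G.neighborFinset v).filter fun w => G.degree w = k).card

/-- `n_{k⁻}(v)`: the number of neighbours of `v` of degree at most `k`. -/
def numNbrsLE (k : ℕ) (v : V) : ℕ :=
  ((G.neighborFinset v).filter fun w => G.degree w ≤ k).card

/-- `x 0, x 1, …, x (k-1)` lists the neighbours of `v`, each exactly once, in nondecreasing order
of degree. -/
def IsSortedNbrs (v : V) {k : ℕ} (x : Fin k → V) : Prop :=
  Function.Injective x ∧ Set.range x = G.neighborSet v ∧ Monotone fun i => G.degree (x i)

/-- (A1): a path `uvw` with `d(v) = 2` and `d(u) ≤ 9`. -/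
def ConfigA1 : Prop :=
  ∃ u v w : V, G.Adj u v ∧ G.Adj v w ∧ u ≠ w ∧ G.degree v = 2 ∧ G.degree u ≤ 9

/-- (A2): a vertex `u` with `n_2(u) ≥ 1`, `n_{8⁻}(u) ≥ d(u) - 8`, and
either `n_{8⁻}(u) ≥ d(u) - 7`, or `n_{8⁻}(u) = d(u) - 8` and `n_2(u) ≥ d(u) - 9`;
the differences are differences of integers. -/
def ConfigA2 : Prop :=
  ∃ u : V, 1 ≤ G.numNbrs 2 u ∧ (G.degree u : ℤ) - 8 ≤ G.numNbrsLE 8 u ∧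
    ((G.degree u : ℤ) - 7 ≤ G.numNbrsLE 8 u ∨
      ((G.numNbrsLE 8 u : ℤ) = (G.degree u : ℤ) - 8 ∧
        (G.degree u : ℤ) - 9 ≤ G.numNbrs 2 u))

/-- (A3): a 3-vertex `u` adjacent to a vertex `v` such that `d(v) ≤ 8`, or `d(v) = 9` and `u`, `v`
have a common neighbour, or `d(v) = 10`, `n_{5⁻}(v) ≥ 5` and `u`, `v` have two common
neighbours. -/
def ConfigA3 : Prop :=
  ∃ u v : V, G.degree u = 3 ∧ G.Adj u v ∧
    (G.degree v ≤ 8 ∨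
      (G.degree v = 9 ∧ ∃ u₂, G.Adj u u₂ ∧ G.Adj v u₂) ∨
      (G.degree v = 10 ∧ 5 ≤ G.numNbrsLE 5 v ∧
        ∃ u₁ u₂, u₁ ≠ u₂ ∧ (G.Adj u u₁ ∧ G.Adj v u₁) ∧ (G.Adj u u₂ ∧ G.Adj v u₂)))

/-- (A4.1): a 4-vertex `v` with neighbours `u = x 0`, `x 1`, `x 2`, `x 3` in nondecreasing order of
degree such that `4 ≤ d(u) ≤ 7` and the two smallest degrees sum to at most 17. -/
def ConfigA41 : Prop :=
  ∃ (v : V) (x : Fin 4 → V), G.degree v = 4 ∧ G.IsSortedNbrs v x ∧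
    4 ≤ G.degree (x 0) ∧ G.degree (x 0) ≤ 7 ∧ G.degree (x 0) + G.degree (x 1) ≤ 17

/-- (A4.2): a 5-vertex `v` with neighbours `u = x 0`, `x 1`, …, `x 4` in nondecreasing order of
degree such that `4 ≤ d(u) ≤ 6` and the three smallest degrees sum to at most 18, or the degrees
are `6, 6, 7, 7, 7` and `u = x 0` is adjacent to `x 4`. -/
def ConfigA42 : Prop :=
  ∃ (v : V) (x : Fin 5 → V), G.degree v = 5 ∧ G.IsSortedNbrs v x ∧
    ((4 ≤ G.degree (x 0) ∧ G.degree (x 0) ≤ 6 ∧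
        G.degree (x 0) + G.degree (x 1) + G.degree (x 2) ≤ 18) ∨
      (G.degree (x 0) = 6 ∧ G.degree (x 1) = 6 ∧
        G.degree (x 2) = 7 ∧ G.degree (x 3) = 7 ∧ G.degree (x 4) = 7 ∧ G.Adj (x 0) (x 4)))

/-- (A4): (A4.1) or (A4.2). -/
def ConfigA4 : Prop :=
  G.ConfigA41 ∨ G.ConfigA42

end Configurations

end SimpleGraph

/-! Suppose that no configuration occurs and delete the vertices of degree 2. The remaining induced
graph (`core`) is planar and nonempty. A vertex that lost no neighbour keeps its degree. A vertex
that did lose one has, since `ConfigA1` and `ConfigA2` are absent, at least eight remaining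
neighbours of degree at least 9, and can pay for everything asked of it. `ConfigFree` collects these
local conditions, with `D` the degree in the original graph, and `ConfigFree.not_isPlanar` refutes
them by discharging.

A vertex starts with charge deg − 6 and every corner of a non-triangular face with 1/2; by Euler's
formula the total is negative (`total_charge`). Each non-triangular side of an edge gives 1/4 to
both ends of the edge, and vertices of degree 3, 4, 5 draw the rest of what they lack from
neighbours of larger degree (`give`). The receivers are treated in `receive_four` and
`receive_five`; 3-vertices balance by definition of the rule. For the senders, a neighbour is
expensive when the faces at the edge are triangles, but the third vertex of such a triangle is
typically a big neighbour of the sender, next in the rotation, and costs nothing. `sum_le_of_local`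
averages over the rotation in this way. Degrees 7 and 11 need separate counts. No vertex ends with
negative charge (`charge_nonneg`), a contradiction.

Euler's formula is needed only as V − E + F ≥ 1, where F counts the orbits of the face permutation,
and it is derived without the Jordan curve theorem. Given an element of the cycle space mod 2, the
parity of the number of its segments above a point of the plane changes exactly when the element is
crossed, and is constant around a face (`aboveParity_transfer`, `leftParity_add_reverse`). So every
cycle is a boundary of faces, and counting dimensions gives E − V + 1 ≤ F
(`euler_of_cycle_space_le`), also for disconnected graphs. -/

namespace SimpleGraph

/-! ### Crossing parity for finitely many segments in the plane. -/

/-- A finite family of non-vertical straight segments, given by left and right ends, with distinct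
abscissas at distinct ends, that meet only in common ends. -/
structure SegmentFamily (S P : Type*) where
  X : P → ℝ
  Y : P → ℝ
  L : S → P
  R : S → P
  lt : ∀ s, X (L s) < X (R s)
  eq_LL : ∀ s t, X (L s) = X (L t) → L s = L t
  eq_RR : ∀ s t, X (R s) = X (R t) → R s = R t
  cross : ∀ s t, s ≠ t → ∀ a, X (L s) ≤ a → a ≤ X (R s) → X (L t) ≤ a → a ≤ X (R t) →
    Y (L s) + (Y (R s) - Y (L s)) / (X (R s) - X (L s)) * (a - X (L s)) =
      Y (L t) + (Y (R t) - Y (L t)) / (X (R t) - X (L t)) * (a - X (L t)) →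
    (a = X (L s) ∨ a = X (R s)) ∧ (a = X (L t) ∨ a = X (R t))

namespace SegmentFamily

variable {S P : Type*} (F : SegmentFamily S P)

/-- The slope of a segment. -/
noncomputable def slope (s : S) : ℝ :=
  (F.Y (F.R s) - F.Y (F.L s)) / (F.X (F.R s) - F.X (F.L s))

/-- The ordinate of the point of the line through a segment that has abscissa `a`. -/
noncomputable def height (s : S) (a : ℝ) : ℝ :=
  F.Y (F.L s) + F.slope s * (a - F.X (F.L s))

theorem height_L (s : S) : F.height s (F.X (F.L s)) = F.Y (F.L s) := by
  simp [height]

theorem height_R (s : S) : F.height s (F.X (F.R s)) = F.Y (F.R s) := by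
  have := F.lt s
  have h : F.X (F.R s) - F.X (F.L s) ≠ 0 := by linarith
  unfold height slope
  field_simp
  ring

theorem height_add (s : S) (a b : ℝ) :
    F.height s b = F.height s a + F.slope s * (b - a) := by
  unfold height; ring

theorem end_of_height_eq {s t : S} (hst : s ≠ t) {a : ℝ} (h₁ : F.X (F.L s) ≤ a)
    (h₂ : a ≤ F.X (F.R s)) (h₃ : F.X (F.L t) ≤ a) (h₄ : a ≤ F.X (F.R t))
    (h : F.height s a = F.height t a) :
    (a = F.X (F.L s) ∨ a = F.X (F.R s)) ∧ (a = F.X (F.L t) ∨ a = F.X (F.R t)) :=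
  F.cross s t hst a h₁ h₂ h₃ h₄ h

/-- An affine function without zeros in a half-open interval that is nonzero at the other end has
constant sign. -/
theorem affine_sign {p q a m : ℝ}
    (h : ∀ θ : ℝ, 0 < θ → θ ≤ 1 → p + q * (θ * (m - a)) ≠ 0) (h0 : p ≠ 0) :
    0 < p ↔ 0 < p + q * (m - a) := by
  have h1 := h 1 one_pos le_rfl
  rw [one_mul] at h1
  -- With opposite signs at the two ends, the affine function would vanish at θ = −p / (q (m − a)),
  -- which lies in (0, 1].
  have key : ¬ p * (p + q * (m - a)) < 0 := by
    intro hneg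
    have hd : q * (m - a) ≠ 0 := by
      intro h0'
      rw [h0', add_zero] at hneg
      nlinarith [sq_nonneg p]
    refine h (-p / (q * (m - a))) ?_ ?_ ?_
    · rcases lt_or_gt_of_ne h0 with hp | hp
      · have : 0 < p + q * (m - a) := by
          by_contra hc
          nlinarith
        exact div_pos (by linarith) (by linarith)
      · have : p + q * (m - a) < 0 := by
          by_contra hc
          nlinarith
        exact div_pos_of_neg_of_neg (by linarith) (by linarith)
    · rcases lt_or_gt_of_ne h0 with hp | hp
      · have : 0 < p + q * (m - a) := by
          by_contra hc
          nlinarith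
        rw [div_le_one (by linarith)]; linarith
      · have : p + q * (m - a) < 0 := by
          by_contra hc
          nlinarith
        rw [div_le_one_of_neg (by linarith)]; linarith
    · have hq : q ≠ 0 := left_ne_zero_of_mul hd
      have hm : m - a ≠ 0 := right_ne_zero_of_mul hd
      field_simp
      ring
  constructor
  · intro hp
    rcases lt_or_gt_of_ne h1 with h2 | h2
    · exact absurd (mul_neg_of_pos_of_neg hp h2) key
    · exact h2
  · intro hp
    rcases lt_or_gt_of_ne h0 with h2 | h2
    · exact absurd (mul_neg_of_neg_of_pos h2 hp) key
    · exact h2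

/-- `t` runs above `s` over the common part of their projections. -/
def Over (s t : S) : Prop :=
  max (F.X (F.L s)) (F.X (F.L t)) < min (F.X (F.R s)) (F.X (F.R t)) ∧
    F.height s ((max (F.X (F.L s)) (F.X (F.L t)) + min (F.X (F.R s)) (F.X (F.R t))) / 2) <
      F.height t ((max (F.X (F.L s)) (F.X (F.L t)) + min (F.X (F.R s)) (F.X (F.R t))) / 2)

/-- Comparing two segments at an abscissa of their common projection where they do not meet. -/
theorem height_lt_iff_over {s t : S} (hst : s ≠ t) {a : ℝ} (h₁ : F.X (F.L s) ≤ a)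
    (h₂ : a ≤ F.X (F.R s)) (h₃ : F.X (F.L t) ≤ a) (h₄ : a ≤ F.X (F.R t))
    (hlt : max (F.X (F.L s)) (F.X (F.L t)) < min (F.X (F.R s)) (F.X (F.R t)))
    (hne : F.height s a ≠ F.height t a) : F.height s a < F.height t a ↔ F.Over s t := by
  set m := (max (F.X (F.L s)) (F.X (F.L t)) + min (F.X (F.R s)) (F.X (F.R t))) / 2 with hm
  have e1 := le_max_left (F.X (F.L s)) (F.X (F.L t))
  have e2 := le_max_right (F.X (F.L s)) (F.X (F.L t))
  have e3 := min_le_left (F.X (F.R s)) (F.X (F.R t))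
  have e4 := min_le_right (F.X (F.R s)) (F.X (F.R t))
  have hmem : ∀ θ : ℝ, 0 < θ → θ ≤ 1 → F.X (F.L s) < a + θ * (m - a) ∧
      a + θ * (m - a) < F.X (F.R s) ∧ F.X (F.L t) ≤ a + θ * (m - a) ∧
      a + θ * (m - a) ≤ F.X (F.R t) := by
    intro θ h0 h1
    have r : a + θ * (m - a) = (1 - θ) * a + θ * m := by ring
    have w : 0 ≤ 1 - θ := by linarith
    rw [r]
    have m1 : F.X (F.L s) < m := by rw [hm]; linarith
    have m2 : m < F.X (F.R s) := by rw [hm]; linarith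
    have m3 : F.X (F.L t) < m := by rw [hm]; linarith
    have m4 : m < F.X (F.R t) := by rw [hm]; linarith
    refine ⟨?_, ?_, ?_, ?_⟩
    · have := mul_le_mul_of_nonneg_left h₁ w
      have := mul_lt_mul_of_pos_left m1 h0
      nlinarith
    · have := mul_le_mul_of_nonneg_left h₂ w
      have := mul_lt_mul_of_pos_left m2 h0
      nlinarith
    · have := mul_le_mul_of_nonneg_left h₃ w
      have := mul_lt_mul_of_pos_left m3 h0
      nlinarith
    · have := mul_le_mul_of_nonneg_left h₄ w
      have := mul_lt_mul_of_pos_left m4 h0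
      nlinarith
  have key := affine_sign (p := F.height t a - F.height s a) (q := F.slope t - F.slope s)
    (a := a) (m := m) (by
      intro θ h0 h1 hz
      obtain ⟨k1, k2, k3, k4⟩ := hmem θ h0 h1
      have := F.end_of_height_eq hst k1.le k2.le k3 k4 (by
        rw [F.height_add s a, F.height_add t a]; linarith)
      rcases this.1 with h | h
      · exact k1.ne' h
      · exact k2.ne h) (sub_ne_zero.2 hne.symm)
  have e5 : F.height t a - F.height s a + (F.slope t - F.slope s) * (m - a) =
      F.height t m - F.height s m := by
    rw [F.height_add s a m, F.height_add t a m]; ring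
  rw [e5, sub_pos, sub_pos] at key
  rw [key, Over]
  exact ⟨fun h => ⟨hlt, h⟩, fun h => h.2⟩

-- Whether `t` runs above `s` can be read off at the left end of their common projection. This is
-- the abscissa of `L s`, where `t` passes above or starts with larger slope, or that of `L t`,
-- which then lies above `s`. The three terms are these exclusive cases.
open Classical in
theorem left_count {A : Type*} [AddMonoid A] {s t : S} (hst : s ≠ t) (c : A) :
    ((if F.X (F.L t) < F.X (F.L s) ∧ F.X (F.L s) < F.X (F.R t) ∧
        F.Y (F.L s) < F.height t (F.X (F.L s)) then c else 0) +
      (if F.L t = F.L s ∧ F.slope s < F.slope t then c else 0)) +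
      (if F.X (F.L s) < F.X (F.L t) ∧ F.X (F.L t) < F.X (F.R s) ∧
        F.height s (F.X (F.L t)) < F.Y (F.L t) then c else 0) =
    if F.Over s t then c else 0 := by
  have hs := F.lt s
  have ht := F.lt t
  rcases lt_trichotomy (F.X (F.L t)) (F.X (F.L s)) with h | h | h
  · have h2 : F.L t ≠ F.L s := fun e => h.ne (by rw [e])
    have h3 : ¬ F.X (F.L s) < F.X (F.L t) := h.le.not_gt
    simp only [h, h2, h3, true_and, false_and, if_false, add_zero]
    congr 1
    rw [eq_iff_iff]
    by_cases h4 : F.X (F.L s) < F.X (F.R t)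
    · simp only [h4, true_and]
      rw [← F.height_L s]
      refine F.height_lt_iff_over hst le_rfl hs.le h.le h4.le ?_ ?_
      · simp [hs, h4, ht, h.trans hs]
      · intro e
        have := (F.end_of_height_eq hst le_rfl hs.le h.le h4.le e).2
        rcases this with e | e <;> linarith
    · simp only [h4, false_and, Over, false_iff, not_and]
      intro h5
      exact absurd ((le_max_left _ _).trans_lt (h5.trans_le (min_le_right _ _))) h4
  · have h2 : F.L t = F.L s := F.eq_LL t s h
    simp only [h2, true_and, false_and, lt_irrefl, if_false, add_zero, zero_add]
    congr 1
    rw [eq_iff_iff, Over, h]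
    rw [h] at ht
    have h5 : max (F.X (F.L s)) (F.X (F.L s)) < min (F.X (F.R s)) (F.X (F.R t)) := by
      simp [hs, ht]
    rw [max_self] at h5 ⊢
    simp only [h5, true_and, height, h2]
    have : 0 < (F.X (F.L s) + min (F.X (F.R s)) (F.X (F.R t))) / 2 - F.X (F.L s) := by linarith
    rw [add_lt_add_iff_left, mul_lt_mul_iff_left₀ this]
  · have h2 : F.L t ≠ F.L s := fun e => h.ne (by rw [e])
    have h3 : ¬ F.X (F.L t) < F.X (F.L s) := h.le.not_gt
    simp only [h, h2, h3, true_and, false_and, if_false, zero_add]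
    congr 1
    rw [eq_iff_iff]
    by_cases h4 : F.X (F.L t) < F.X (F.R s)
    · simp only [h4, true_and]
      rw [← F.height_L t]
      refine F.height_lt_iff_over hst h.le h4.le le_rfl ht.le ?_ ?_
      · simp [hs, h4, ht, h.trans ht]
      · intro e
        have := (F.end_of_height_eq hst h.le h4.le le_rfl ht.le e).1
        rcases this with e | e <;> linarith
    · simp only [h4, false_and, Over, false_iff, not_and]
      intro h5
      exact absurd ((le_max_right _ _).trans_lt (h5.trans_le (min_le_left _ _))) h4

-- Mirror image of `left_count`, read off at the right end of the common projection. Among segments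
-- ending in a common point, the upper one has the smaller slope. The right-hand sides agree, so the
-- two counts can be compared.
open Classical in
theorem right_count {A : Type*} [AddMonoid A] {s t : S} (hst : s ≠ t) (c : A) :
    ((if F.X (F.L t) < F.X (F.R s) ∧ F.X (F.R s) < F.X (F.R t) ∧
        F.Y (F.R s) < F.height t (F.X (F.R s)) then c else 0) +
      (if F.R t = F.R s ∧ F.slope t < F.slope s then c else 0)) +
      (if F.X (F.L s) < F.X (F.R t) ∧ F.X (F.R t) < F.X (F.R s) ∧
        F.height s (F.X (F.R t)) < F.Y (F.R t) then c else 0) =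
    if F.Over s t then c else 0 := by
  have hs := F.lt s
  have ht := F.lt t
  rcases lt_trichotomy (F.X (F.R s)) (F.X (F.R t)) with h | h | h
  · have h2 : F.R t ≠ F.R s := fun e => h.ne (by rw [e])
    have h3 : ¬ F.X (F.R t) < F.X (F.R s) := h.le.not_gt
    simp only [h, h2, h3, true_and, false_and, and_false, if_false, add_zero]
    congr 1
    rw [eq_iff_iff]
    by_cases h4 : F.X (F.L t) < F.X (F.R s)
    · simp only [h4, true_and]
      rw [← F.height_R s]
      refine F.height_lt_iff_over hst hs.le le_rfl h4.le h.le ?_ ?_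
      · simp [hs, h4, ht, hs.trans h]
      · intro e
        have := (F.end_of_height_eq hst hs.le le_rfl h4.le h.le e).2
        rcases this with e | e <;> linarith
    · simp only [h4, false_and, Over, false_iff, not_and]
      intro h5
      exact absurd ((le_max_right _ _).trans_lt (h5.trans_le (min_le_left _ _))) h4
  · have h2 : F.R t = F.R s := (F.eq_RR s t h).symm
    simp only [h2, true_and, false_and, and_false, lt_irrefl, if_false, add_zero,
      zero_add]
    congr 1
    rw [eq_iff_iff, Over, ← h]
    rw [← h] at ht
    have h5 : max (F.X (F.L s)) (F.X (F.L t)) < min (F.X (F.R s)) (F.X (F.R s)) := by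
      simp [hs, ht]
    rw [min_self] at h5 ⊢
    simp only [h5, true_and]
    set m := (max (F.X (F.L s)) (F.X (F.L t)) + F.X (F.R s)) / 2 with hm
    rw [F.height_add s (F.X (F.R s)) m, F.height_add t (F.X (F.R s)) m, F.height_R s]
    nth_rewrite 2 [← h2]
    rw [show F.X (F.R s) = F.X (F.R t) from h, F.height_R t, h2, add_lt_add_iff_left]
    have : m - F.X (F.R s) < 0 := by rw [hm]; linarith
    exact (mul_lt_mul_right_of_neg this).symm
  · have h2 : F.R t ≠ F.R s := fun e => h.ne (by rw [e])
    have h3 : ¬ F.X (F.R s) < F.X (F.R t) := h.le.not_gt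
    simp only [h, h2, h3, true_and, false_and, and_false, if_false, zero_add]
    congr 1
    rw [eq_iff_iff]
    by_cases h4 : F.X (F.L s) < F.X (F.R t)
    · simp only [h4, true_and]
      rw [← F.height_R t]
      refine F.height_lt_iff_over hst h4.le h.le ht.le le_rfl ?_ ?_
      · simp [hs, h4, ht, ht.trans h]
      · intro e
        have := (F.end_of_height_eq hst h4.le h.le ht.le le_rfl e).1
        rcases this with e | e <;> linarith
    · simp only [h4, false_and, Over, false_iff, not_and]
      intro h5
      exact absurd ((le_max_left _ _).trans_lt (h5.trans_le (min_le_right _ _))) h4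

/-- The starting point of a directed segment; `false` means directed to the right. -/
def base (d : S × Bool) : P := bif d.2 then F.R d.1 else F.L d.1

/-- Directed segments with the same starting point are in counterclockwise order, from straight
down, when they are ordered by this key. -/
noncomputable def key (d : S × Bool) : Bool ×ₗ ℝ := toLex (d.2, F.slope d.1)

/-- Two different segments leaving a point on the same side with the same slope would overlap near
it, against `cross`. -/
theorem key_injOn {d d' : S × Bool} (hb : F.base d = F.base d') (hk : F.key d = F.key d') :
    d = d' := by
  obtain ⟨s, b⟩ := d
  obtain ⟨t, b'⟩ := d'
  have h := toLex_inj.1 hk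
  simp only [Prod.mk.injEq] at h
  obtain ⟨rfl, hsl⟩ := h
  by_contra hne
  have hst : s ≠ t := fun h => hne (by rw [h])
  have hs := F.lt s
  have ht := F.lt t
  cases b
  · have hb' : F.L s = F.L t := hb
    rw [← hb'] at ht
    set a := min (F.X (F.R s)) (F.X (F.R t)) with ha
    have h1 : F.X (F.L s) < a := lt_min hs ht
    have h2 : a ≤ F.X (F.R s) := min_le_left _ _
    have h3 : a ≤ F.X (F.R t) := min_le_right _ _
    set m := (F.X (F.L s) + a) / 2 with hm
    have := (F.end_of_height_eq hst (a := m) (by linarith) (by linarith)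
      (by rw [← hb']; linarith) (by linarith) (by unfold height; rw [hb', hsl])).1
    rcases this with e | e <;> linarith
  · have hb' : F.R s = F.R t := hb
    rw [← hb'] at ht
    set a := max (F.X (F.L s)) (F.X (F.L t)) with ha
    have h1 : a < F.X (F.R s) := max_lt hs ht
    have h2 : F.X (F.L s) ≤ a := le_max_left _ _
    have h3 : F.X (F.L t) ≤ a := le_max_right _ _
    set m := (F.X (F.R s) + a) / 2 with hm
    have := (F.end_of_height_eq hst (a := m) (by linarith) (by linarith)
      (by linarith) (by rw [← hb']; linarith) (by
        rw [F.height_add s (F.X (F.R s)) m, F.height_add t (F.X (F.R t)) m, F.height_R,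
          F.height_R, hsl, hb'])).1
    rcases this with e | e <;> linarith

section Parity

variable [Fintype S] (c : S → ZMod 2)

open Classical in
/-- The number, mod 2, of segments counted by `c` strictly above the point `q`. -/
noncomputable def aboveParity (q : P) : ZMod 2 :=
  ∑ t, if F.X (F.L t) < F.X q ∧ F.X q < F.X (F.R t) ∧ F.Y q < F.height t (F.X q) then c t else 0

open Classical in
/-- The parity of the region just below the point `q`. -/
noncomputable def belowParity (q : P) : ZMod 2 :=
  -- The upward ray from just below `q` is pushed slightly to the right, so it meets the segments
  -- starting at `q` and not those ending there.
  F.aboveParity c q + ∑ t, if F.L t = q then c t else 0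

open Classical in
/-- The parity of the region on the left of a directed segment, near its start. -/
noncomputable def leftParity (d : S × Bool) : ZMod 2 :=
  F.belowParity c (F.base d) +
    ∑ d' : S × Bool, if F.base d' = F.base d ∧ F.key d' ≤ F.key d then c d'.1 else 0

variable {c}

-- Moving along the upper side of `s`, the number of segments above can change only at ends of
-- segments lying strictly above `s`. Each such point carries an even number of counted ends, so the
-- parity does not change. Formally, `left_count` and `right_count` are summed over `t`, and the
-- ends in the region `M` above `s` cancel mod 2.
open Classical in
theorem aboveParity_transfer
    (hc : ∀ q, ∑ d : S × Bool, (if F.base d = q then c d.1 else 0) = 0) (s : S) :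
    F.aboveParity c (F.L s) +
        (∑ t, if F.L t = F.L s ∧ F.slope s < F.slope t then c t else 0) =
      F.aboveParity c (F.R s) +
        ∑ t, if F.R t = F.R s ∧ F.slope t < F.slope s then c t else 0 := by
  let M : P → Prop := fun q =>
    F.X (F.L s) < F.X q ∧ F.X q < F.X (F.R s) ∧ F.height s (F.X q) < F.Y q
  have hM : ∑ d : S × Bool, (if M (F.base d) then c d.1 else 0) = 0 := by
    have : ∀ d : S × Bool, (if M (F.base d) then c d.1 else 0) =
        ∑ q ∈ Finset.univ.image F.base,
          if M q then (if F.base d = q then c d.1 else 0) else 0 := by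
      intro d
      rw [Finset.sum_eq_single (F.base d)]
      · simp
      · intro q _ hq
        simp [hq.symm]
      · intro h
        exact absurd (Finset.mem_image_of_mem _ (Finset.mem_univ _)) h
    simp_rw [this]
    rw [Finset.sum_comm]
    refine Finset.sum_eq_zero fun q _ => ?_
    by_cases hq : M q
    · simpa [hq] using hc q
    · simp [hq]
  have hsum : (F.aboveParity c (F.L s) +
        (∑ t, if F.L t = F.L s ∧ F.slope s < F.slope t then c t else 0)) +
      (∑ t, if M (F.L t) then c t else 0) =
      (F.aboveParity c (F.R s) +
        ∑ t, if F.R t = F.R s ∧ F.slope t < F.slope s then c t else 0) +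
      (∑ t, if M (F.R t) then c t else 0) := by
    unfold aboveParity
    simp only [← Finset.sum_add_distrib]
    refine Finset.sum_congr rfl fun t _ => ?_
    by_cases hst : s = t
    · subst hst
      simp [M]
    · exact (F.left_count hst (c t)).trans (F.right_count hst (c t)).symm
  have hM' : (∑ t, if M (F.R t) then c t else 0) + (∑ t, if M (F.L t) then c t else 0) = 0 := by
    refine Eq.trans ?_ hM
    rw [Fintype.sum_prod_type, ← Finset.sum_add_distrib]
    refine Finset.sum_congr rfl fun t _ => ?_
    rw [Fintype.sum_bool]
    rfl
  rw [CharTwo.add_eq_zero.1 hM'] at hsum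
  exact add_right_cancel hsum

-- The left of a segment directed to the right is its upper side. Segments that start at the same
-- point with slope at most that of `s` are counted twice and cancel.
open Classical in
theorem leftParity_false (s : S) : F.leftParity c (s, false) = F.aboveParity c (F.L s) +
    ∑ t, if F.L t = F.L s ∧ F.slope s < F.slope t then c t else 0 := by
  unfold leftParity belowParity
  rw [Fintype.sum_prod_type]
  simp only [Fintype.sum_bool]
  rw [add_assoc, ← Finset.sum_add_distrib]
  congr 1
  refine Finset.sum_congr rfl fun t _ => ?_
  simp only [base, key, cond_true, cond_false, Prod.Lex.toLex_le_toLex, lt_irrefl, true_and,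
    false_or]
  have hlt : ¬ true < false := by decide
  by_cases h : F.L t = F.L s
  · by_cases h' : F.slope t ≤ F.slope s
    · simp [h, h', h'.not_gt, hlt, CharTwo.add_self_eq_zero]
    · simp [h, h', hlt, not_le.1 h']
  · simp [h]

-- The left of a segment directed to the left is its lower side, hence the extra term `c s`.
open Classical in
theorem leftParity_true (s : S) : F.leftParity c (s, true) = F.aboveParity c (F.R s) +
    (∑ t, if F.R t = F.R s ∧ F.slope t < F.slope s then c t else 0) + c s := by
  have hs : c s = ∑ t, if t = s then c t else 0 := by simp
  unfold leftParity belowParity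
  rw [hs, Fintype.sum_prod_type]
  simp only [Fintype.sum_bool]
  rw [add_assoc, add_assoc, ← Finset.sum_add_distrib, ← Finset.sum_add_distrib]
  congr 1
  refine Finset.sum_congr rfl fun t _ => ?_
  simp only [base, key, cond_true, cond_false, Prod.Lex.toLex_le_toLex, lt_irrefl, true_and,
    false_or, Bool.false_lt_true, true_or, and_true]
  have h0 (x y : ZMod 2) : x + (y + x) = y := by
    rw [add_left_comm, CharTwo.add_self_eq_zero, add_zero]
  refine (h0 _ _).trans ?_
  by_cases h : F.R t = F.R s
  · rcases lt_trichotomy (F.slope t) (F.slope s) with h' | h' | h'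
    · have : t ≠ s := fun e => h'.ne (by rw [e])
      simp [h, h', h'.le, this]
    · have : t = s := congrArg Prod.fst
        (F.key_injOn (d := (t, true)) (d' := (s, true)) h (by simp [key, h']))
      subst this
      simp
    · have : t ≠ s := fun e => h'.ne (by rw [e])
      simp [h'.not_ge, h'.le.not_gt, this]
  · have : t ≠ s := fun e => h (by rw [e])
    simp [h, this]

-- The left sides of the two directions are the upper and the lower side of `s`. By
-- `aboveParity_transfer` the upper side has the same parity at both ends.
open Classical in
theorem leftParity_add_reverse
    (hc : ∀ q, ∑ d : S × Bool, (if F.base d = q then c d.1 else 0) = 0) (s : S) (b : Bool) :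
    F.leftParity c (s, b) + F.leftParity c (s, !b) = c s := by
  have h : F.leftParity c (s, false) + F.leftParity c (s, true) = c s := by
    rw [leftParity_false, leftParity_true, F.aboveParity_transfer hc s, ← add_assoc,
      CharTwo.add_self_eq_zero, zero_add]
  cases b
  · exact h
  · rw [add_comm]; exact h

open Classical in
/-- At a point with exactly two directed segments the parity switches from one to the other as
across a segment. -/
theorem leftParity_add_of_pair {d e : S × Bool} (hde : d ≠ e) (hb : F.base d = F.base e)
    (hpair : ∀ f, F.base f = F.base d → f = d ∨ f = e) (hc : c d.1 = c e.1) :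
    F.leftParity c d + F.leftParity c e = c d.1 := by
  wlog h : F.key d < F.key e generalizing d e
  · have hk : F.key d ≠ F.key e := fun h => hde (F.key_injOn hb h)
    rw [add_comm, hc]
    exact this hde.symm hb.symm (fun f hf => (hpair f (hf.trans hb.symm)).symm) hc.symm
      (lt_of_le_of_ne (not_lt.1 h) hk.symm)
  -- Turning counterclockwise from straight down, only `d` has been passed on reaching `d`; on
  -- reaching `e` both have, and they cancel.
  have hd : ∑ f : S × Bool, (if F.base f = F.base d ∧ F.key f ≤ F.key d then c f.1 else 0)
      = c d.1 := by
    rw [Finset.sum_eq_single d]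
    · simp
    · intro f _ hf
      by_cases hfb : F.base f = F.base d
      · rcases hpair f hfb with rfl | rfl
        · exact absurd rfl hf
        · simp [h.not_ge]
      · simp [hfb]
    · simp
  have he : ∑ f : S × Bool, (if F.base f = F.base e ∧ F.key f ≤ F.key e then c f.1 else 0)
      = 0 := by
    rw [Finset.sum_eq_add d e hde]
    · simp [hb, h.le, hc, CharTwo.add_self_eq_zero]
    · intro f _ hf
      by_cases hfb : F.base f = F.base d
      · rcases hpair f hfb with h | h
        · exact absurd h hf.1
        · exact absurd h hf.2
      · simp [← hb, hfb]
    · simp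
    · simp
  unfold leftParity
  rw [hd, he, hb, add_zero, add_right_comm, CharTwo.add_self_eq_zero, zero_add]

end Parity

end SegmentFamily

end SimpleGraph

/-! ### Rotation systems, and Euler's inequality from the cycle space. -/

namespace SimpleGraph

/-- The cyclic permutation that takes each element to its successor with respect to `key`. -/
theorem exists_cyclic_successor {A K : Type*} [Fintype A] [LinearOrder K] (key : A → K)
    (hkey : Function.Injective key) :
    ∃ σ : Equiv.Perm A, (∀ a b, σ.SameCycle a b) ∧
      ∀ c : A → ZMod 2, ∑ a, c a = 0 → ∀ a,
        (∑ b, if key b ≤ key (σ a) then c b else 0) =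
          (∑ b, if key b ≤ key a then c b else 0) + c (σ a) := by
  classical
  rcases isEmpty_or_nonempty A with hA | hA
  · exact ⟨1, fun a => hA.elim a, fun _ _ a => hA.elim a⟩
  obtain ⟨n, hn⟩ : ∃ n, Fintype.card A = n + 1 :=
    ⟨Fintype.card A - 1, (Nat.succ_pred_eq_of_pos Fintype.card_pos).symm⟩
  let _ : LinearOrder A := LinearOrder.lift' key hkey
  have hle : ∀ a b : A, key a ≤ key b ↔ a ≤ b := fun a b => Iff.rfl
  let e : Fin (n + 1) ≃o A := Fintype.orderIsoFinOfCardEq A hn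
  let σ : Equiv.Perm A := (e.symm.toEquiv.trans (finRotate (n + 1))).trans e.toEquiv
  have hσ : ∀ i, σ (e i) = e (i + 1) := by
    intro i
    simp [σ]
  refine ⟨σ, ?_, ?_⟩
  · have h0 : ∀ (k : ℕ) (hk : k < n + 1), (σ ^ k) (e 0) = e ⟨k, hk⟩ := by
      intro k
      induction k with
      | zero => intro _; rfl
      | succ k ih =>
        intro hk
        rw [pow_succ', Equiv.Perm.mul_apply, ih (by omega), hσ]
        congr 1
        apply Fin.ext
        rw [Fin.val_add_one_of_lt (Fin.lt_def.2 (by simpa using hk))]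
    have h1 : ∀ a, σ.SameCycle (e 0) a := by
      intro a
      refine ⟨((e.symm a : Fin (n + 1)) : ℕ), ?_⟩
      rw [zpow_natCast, h0 _ (e.symm a).2]
      simp
    exact fun a b => (h1 a).symm.trans (h1 b)
  · intro c hc a
    obtain ⟨j, rfl⟩ := e.surjective a
    rw [hσ]
    have hs : ∀ j, (∑ b, if key b ≤ key (e j) then c b else 0) =
        ∑ i, if i ≤ j then c (e i) else 0 := by
      intro j
      rw [← e.toEquiv.sum_comp]
      refine Finset.sum_congr rfl fun i _ => ?_
      simp only [hle]
      simp
    rw [hs, hs]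
    -- At the wrap-around the full sum is 0 by hypothesis, so the prefix sums start again
    -- consistently.
    rcases eq_or_ne j (Fin.last n) with rfl | hj
    · rw [Fin.last_add_one]
      have : ∑ i, (if i ≤ Fin.last n then c (e i) else 0) = 0 := by
        simp only [Fin.le_last, if_true]
        rw [← hc]
        exact e.toEquiv.sum_comp c
      rw [this, zero_add, Finset.sum_eq_single 0]
      · simp
      · intro b _ hb
        simp [hb]
      · simp
    · have hlt : j < Fin.last n := lt_of_le_of_ne (Fin.le_last _) hj
      have hval : ((j + 1 : Fin (n + 1)) : ℕ) = j + 1 := Fin.val_add_one_of_lt hlt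
      have : c (e (j + 1)) = ∑ i, if i = j + 1 then c (e i) else 0 := by simp
      rw [this, ← Finset.sum_add_distrib]
      refine Finset.sum_congr rfl fun i _ => ?_
      rcases lt_trichotomy (i : ℕ) (j + 1 : ℕ) with h | h | h
      · have h1 : i ≤ j + 1 := by rw [Fin.le_def, hval]; omega
        have h2 : i ≤ j := by rw [Fin.le_def]; omega
        have h3 : i ≠ j + 1 := by intro h'; rw [h', hval] at h; omega
        simp [h1, h2, h3]
      · have h3 : i = j + 1 := by apply Fin.ext; rw [hval, h]
        have h2 : ¬ i ≤ j := by rw [Fin.le_def]; omega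
        subst h3
        simp [h2]
      · have h1 : ¬ i ≤ j + 1 := by rw [Fin.le_def, hval]; omega
        have h2 : ¬ i ≤ j := by rw [Fin.le_def]; omega
        have h3 : i ≠ j + 1 := by intro h'; rw [h', hval] at h; omega
        simp [h1, h2, h3]

variable {V : Type*} (G : SimpleGraph V)

/-- A rotation system: a cyclic order of the darts at each vertex. -/
structure RotationSystem where
  rot : Equiv.Perm G.Dart
  rot_fst : ∀ d, (rot d).fst = d.fst
  sameCycle : ∀ d d' : G.Dart, d.fst = d'.fst → rot.SameCycle d d'

/-- The reversal of darts as a permutation. -/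
def dartReverse : Equiv.Perm G.Dart :=
  ⟨Dart.symm, Dart.symm, Dart.symm_symm, Dart.symm_symm⟩

variable {G}

/-- The permutation that traverses the faces, keeping them on the left. -/
def RotationSystem.face (ρ : G.RotationSystem) : Equiv.Perm G.Dart :=
  ρ.rot⁻¹ * G.dartReverse

theorem RotationSystem.face_apply (ρ : G.RotationSystem) (d : G.Dart) :
    ρ.face d = ρ.rot⁻¹ d.symm := rfl

/-- If every element of the cycle space is the boundary of a set of faces, then there are enough
faces for Euler's formula. -/
theorem euler_of_cycle_space_le [Fintype V] [DecidableEq V] [Nonempty V] [DecidableRel G.Adj]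
    (φ : Equiv.Perm G.Dart)
    (h : ∀ c : Sym2 V → ZMod 2,
      (∀ v, ∑ d : G.Dart, (if d.fst = v then c d.edge else 0) = 0) →
      ∃ g : G.Dart → ZMod 2, (∀ d, g (φ d) = g d) ∧ ∀ d, g d + g d.symm = c d.edge) :
    G.edgeFinset.card + 1 ≤
      Fintype.card V + Nat.card (Quotient (Equiv.Perm.SameCycle.setoid φ)) := by
  classical
  let Q := Quotient (Equiv.Perm.SameCycle.setoid φ)
  let _ : Fintype Q := Fintype.ofFinite Q
  let ext : (G.edgeSet → ZMod 2) →ₗ[ZMod 2] (Sym2 V → ZMod 2) :=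
    { toFun := fun c e => if h : e ∈ G.edgeSet then c ⟨e, h⟩ else 0
      map_add' := by
        intro c c'
        funext e
        by_cases h : e ∈ G.edgeSet <;> simp [h]
      map_smul' := by
        intro a c
        funext e
        by_cases h : e ∈ G.edgeSet <;> simp [h] }
  have hext : ∀ c (d : G.Dart), ext c d.edge = c ⟨d.edge, d.edge_mem⟩ := by
    intro c d
    simp only [ext, LinearMap.coe_mk, AddHom.coe_mk]
    rw [dif_pos d.edge_mem]
  let B : (G.edgeSet → ZMod 2) →ₗ[ZMod 2] (V → ZMod 2) :=
    { toFun := fun c v => ∑ d : G.Dart, if d.fst = v then ext c d.edge else 0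
      map_add' := by
        intro c c'
        funext v
        simp only [map_add, Pi.add_apply, ← Finset.sum_add_distrib]
        refine Finset.sum_congr rfl fun d _ => ?_
        split_ifs <;> simp
      map_smul' := by
        intro a c
        funext v
        simp only [map_smul, Pi.smul_apply, smul_eq_mul, RingHom.id_apply, Finset.mul_sum]
        refine Finset.sum_congr rfl fun d _ => ?_
        split_ifs <;> simp }
  let sumV : (V → ZMod 2) →ₗ[ZMod 2] ZMod 2 := ∑ v, LinearMap.proj v
  have hsumV : ∀ f, sumV f = ∑ v, f v := by
    intro f
    simp [sumV]
  -- Every edge is counted at both of its ends, so `B` has rank at most |V| − 1 and the cycle space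
  -- `ker B` has dimension at least |E| − |V| + 1.
  have hrange : LinearMap.range B ≤ LinearMap.ker sumV := by
    rintro _ ⟨c, rfl⟩
    rw [LinearMap.mem_ker, hsumV]
    change ∑ v, ∑ d : G.Dart, (if d.fst = v then ext c d.edge else 0) = 0
    rw [Finset.sum_comm]
    simp only [Finset.sum_ite_eq, Finset.mem_univ, if_true]
    refine Finset.sum_involution (fun d _ => d.symm) ?_ ?_ ?_ ?_
    · intro d _
      rw [Dart.edge_symm, CharTwo.add_self_eq_zero]
    · intro d _ _
      exact d.symm_ne
    · intro d _; exact Finset.mem_univ _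
    · intro d _; exact d.symm_symm
  have hker : Module.finrank (ZMod 2) (LinearMap.ker sumV) + 1 = Fintype.card V := by
    have h1 := LinearMap.finrank_range_add_finrank_ker sumV
    have h2 : LinearMap.range sumV = ⊤ := by
      rw [LinearMap.range_eq_top]
      intro a
      obtain ⟨v⟩ := ‹Nonempty V›
      refine ⟨Pi.single v a, ?_⟩
      rw [hsumV]
      simp
    rw [h2, finrank_top, Module.finrank_self, Module.finrank_fintype_fun_eq_card] at h1
    omega
  have hB := LinearMap.finrank_range_add_finrank_ker B
  have hBr := Submodule.finrank_mono hrange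
  let T : (Q → ZMod 2) →ₗ[ZMod 2] (G.Dart → ZMod 2) :=
    { toFun := fun g d => g (Quotient.mk _ d) + g (Quotient.mk _ d.symm)
      map_add' := by intro g g'; funext d; simp only [Pi.add_apply]; ring
      map_smul' := by intro a g; funext d; simp [mul_add] }
  let R : (G.edgeSet → ZMod 2) →ₗ[ZMod 2] (G.Dart → ZMod 2) :=
    { toFun := fun c d => c ⟨d.edge, d.edge_mem⟩
      map_add' := by intro g g'; rfl
      map_smul' := by intro a g; rfl }
  have hR : Function.Injective R := by
    intro c c' hcc
    funext ⟨e, he⟩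
    induction e with
    | _ u v => exact congrFun hcc ⟨(u, v), he⟩
  have hle : (LinearMap.ker B).map R ≤ LinearMap.range T := by
    rintro _ ⟨c, hc, rfl⟩
    obtain ⟨g, hg1, hg2⟩ := h (ext c) (fun v => congrFun hc v)
    have hinv : ∀ d d' : G.Dart, φ.SameCycle d d' → g d = g d' := by
      rintro d d' ⟨k, rfl⟩
      have hz : ∀ k : ℤ, ∀ d, g ((φ ^ k) d) = g d := by
        intro k
        induction k using Int.induction_on with
        | zero => simp
        | succ k ih => intro d; rw [zpow_add_one, Equiv.Perm.mul_apply, ih, hg1]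
        | pred k ih =>
          intro d
          rw [zpow_sub_one, Equiv.Perm.mul_apply, ih]
          rw [← hg1, ← Equiv.Perm.mul_apply, mul_inv_cancel, Equiv.Perm.one_apply]
      exact (hz k d).symm
    refine ⟨fun q => Quotient.lift g hinv q, ?_⟩
    funext d
    change g d + g d.symm = c ⟨d.edge, d.edge_mem⟩
    rw [hg2, hext]
  have h1 := Submodule.finrank_mono hle
  have h2 : Module.finrank (ZMod 2) ((LinearMap.ker B).map R) =
      Module.finrank (ZMod 2) (LinearMap.ker B) :=
    ((LinearMap.ker B).equivMapOfInjective R hR).finrank_eq.symm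
  -- Constant functions lie in the kernel of `T`, so the rank is in fact smaller; the weaker bound
  -- gives V − E + F ≥ 1, which is enough for discharging.
  have h3 : Module.finrank (ZMod 2) (LinearMap.range T) ≤ Fintype.card Q := by
    refine (LinearMap.finrank_range_le T).trans ?_
    rw [Module.finrank_fintype_fun_eq_card]
  rw [Module.finrank_fintype_fun_eq_card] at hB
  have h5 : Nat.card (Quotient (Equiv.Perm.SameCycle.setoid φ)) = Fintype.card Q :=
    Nat.card_eq_fintype_card
  have h4 : G.edgeFinset.card = Fintype.card G.edgeSet := by
    rw [edgeFinset, Set.toFinset_card]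
  omega

end SimpleGraph

/-! ### Polygonal arcs, and their segments in general position. -/

namespace SimpleGraph

/-- `p 0, …, p n` are the successive bends of a polygonal arc from `a` to `b` with point set `A`. -/
structure IsArcPath (a b : Plane) (A : Set Plane) (n : ℕ) (p : ℕ → Plane) : Prop where
  pos : 0 < n
  first : p 0 = a
  last : p n = b
  ne : ∀ i, i < n → p i ≠ p (i + 1)
  consecutive : ∀ i, i + 1 < n →
    segment ℝ (p i) (p (i + 1)) ∩ segment ℝ (p (i + 1)) (p (i + 2)) = {p (i + 1)}
  disjoint : ∀ i j, i + 1 < j → j < n →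
    Disjoint (segment ℝ (p i) (p (i + 1))) (segment ℝ (p j) (p (j + 1)))
  eq : A = ⋃ i ∈ Set.Iio n, segment ℝ (p i) (p (i + 1))

theorem IsArc.exists_path {a b : Plane} {A : Set Plane} (h : IsArc a b A) :
    ∃ n p, IsArcPath a b A n p := by
  obtain ⟨n, p, h1, h2, h3, h4, h5, h6, h7⟩ := h
  exact ⟨n, p, h1, h2, h3, h4, h5, h6, h7⟩

namespace IsArcPath

variable {a b : Plane} {A : Set Plane} {n : ℕ} {p : ℕ → Plane} (h : IsArcPath a b A n p)
include h

theorem ne_of_lt {i j : ℕ} (hij : i < j) (hj : j ≤ n) : p i ≠ p j := by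
  intro e
  obtain ⟨k, rfl⟩ : ∃ k, j = k + 1 := ⟨j - 1, by omega⟩
  rcases lt_trichotomy k (i + 1) with hk | hk | hk
  · obtain rfl : k = i := by omega
    exact h.ne k (by omega) e
  · subst hk
    have : p i ∈ segment ℝ (p i) (p (i + 1)) ∩ segment ℝ (p (i + 1)) (p (i + 2)) :=
      ⟨left_mem_segment _ _ _, by rw [e]; exact right_mem_segment _ _ _⟩
    rw [h.consecutive i (by omega)] at this
    exact h.ne i (by omega) this
  · exact Set.disjoint_left.1 (h.disjoint i k (by omega) (by omega)) (left_mem_segment _ _ _)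
      (by rw [e]; exact right_mem_segment _ _ _)

theorem eq_of_eq {i j : ℕ} (hi : i ≤ n) (hj : j ≤ n) (e : p i = p j) : i = j := by
  rcases lt_trichotomy i j with hij | hij | hij
  · exact absurd e (h.ne_of_lt hij hj)
  · exact hij
  · exact absurd e.symm (h.ne_of_lt hij hi)

theorem segment_subset {i : ℕ} (hi : i < n) : segment ℝ (p i) (p (i + 1)) ⊆ A := by
  rw [h.eq]
  exact Set.subset_biUnion_of_mem (u := fun i => segment ℝ (p i) (p (i + 1))) hi

theorem mem {i : ℕ} (hi : i ≤ n) : p i ∈ A := by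
  rcases hi.lt_or_eq with hi | rfl
  · exact h.segment_subset hi (left_mem_segment _ _ _)
  · have := h.pos
    obtain ⟨k, rfl⟩ : ∃ k, i = k + 1 := ⟨i - 1, by omega⟩
    exact h.segment_subset (Nat.lt_succ_self k) (right_mem_segment _ _ _)

theorem inter_of_lt {i j : ℕ} (hij : i < j) (hj : j < n) {z : Plane}
    (hi : z ∈ segment ℝ (p i) (p (i + 1))) (hz : z ∈ segment ℝ (p j) (p (j + 1))) :
    z = p (i + 1) ∧ z = p j := by
  rcases (Nat.succ_le_of_lt hij).eq_or_lt with rfl | hlt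
  · have : z ∈ segment ℝ (p i) (p (i + 1)) ∩ segment ℝ (p (i + 1)) (p (i + 2)) := ⟨hi, hz⟩
    rw [h.consecutive i hj] at this
    exact ⟨this, this⟩
  · exact absurd hz (Set.disjoint_left.1 (h.disjoint i j hlt hj) hi)

theorem inter_of_ne {i j : ℕ} (hij : i ≠ j) (hin : i < n) (hjn : j < n) {z : Plane}
    (hi : z ∈ segment ℝ (p i) (p (i + 1))) (hz : z ∈ segment ℝ (p j) (p (j + 1))) :
    (z = p i ∨ z = p (i + 1)) ∧ (z = p j ∨ z = p (j + 1)) := by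
  rcases lt_or_gt_of_ne hij with hl | hl
  · obtain ⟨h1, h2⟩ := h.inter_of_lt hl hjn hi hz
    exact ⟨Or.inr h1, Or.inl h2⟩
  · obtain ⟨h1, h2⟩ := h.inter_of_lt hl hin hz hi
    exact ⟨Or.inl h2, Or.inr h1⟩

/-- An end of the arc also lies on the first or the last segment, so `inter_of_ne` applies to any
other segment containing it. -/
theorem end_of_mem {i : ℕ} (hi : i < n) {z : Plane} (hz : z = a ∨ z = b)
    (hm : z ∈ segment ℝ (p i) (p (i + 1))) : z = p i ∨ z = p (i + 1) := by
  have hn := h.pos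
  rcases hz with rfl | rfl
  · rw [← h.first] at hm ⊢
    by_cases h0 : i = 0
    · subst h0; exact Or.inl rfl
    · exact (h.inter_of_ne (i := 0) (Ne.symm h0) hn hi (left_mem_segment _ _ _) hm).2
  · rw [← h.last] at hm ⊢
    obtain ⟨k, rfl⟩ : ∃ k, n = k + 1 := ⟨n - 1, by omega⟩
    by_cases h0 : i = k
    · subst h0; exact Or.inr rfl
    · exact (h.inter_of_ne (i := k) (Ne.symm h0) (by omega) hi (right_mem_segment _ _ _) hm).2

end IsArcPath

/-- A direction of projection that separates finitely many points. -/
theorem exists_separating_projection {Q : Set Plane} (hQ : Q.Finite) :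
    ∃ ε : ℝ, ∀ p ∈ Q, ∀ q ∈ Q, p 0 + ε * p 1 = q 0 + ε * q 1 → p = q := by
  have hfin : (Set.image2 (fun p q : Plane => -(p 0 - q 0) / (p 1 - q 1)) Q Q).Finite :=
    hQ.image2 _ hQ
  obtain ⟨ε, hε⟩ := hfin.infinite_compl.nonempty
  refine ⟨ε, fun p hp q hq e => ?_⟩
  by_cases h1 : p 1 = q 1
  · ext i
    fin_cases i
    · rw [h1] at e
      exact add_right_cancel e
    · exact h1
  · refine absurd ⟨p, hp, q, hq, ?_⟩ hε
    have : p 1 - q 1 ≠ 0 := sub_ne_zero.2 h1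
    simp only
    rw [div_eq_iff this]
    linarith

/-- Finitely many segments of the plane that meet only in common ends form a segment family. -/
theorem exists_segmentFamily {S : Type*} [Finite S] (a b : S → Plane) (hne : ∀ s, a s ≠ b s)
    (hcross : ∀ s t, s ≠ t → ∀ z ∈ segment ℝ (a s) (b s), z ∈ segment ℝ (a t) (b t) →
      (z = a s ∨ z = b s) ∧ (z = a t ∨ z = b t)) :
    ∃ (F : SegmentFamily S Plane) (flip : S → Bool),
      ∀ s, F.base (s, flip s) = a s ∧ F.base (s, !flip s) = b s := by
  classical
  obtain ⟨ε, hε⟩ := exists_separating_projection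
    ((Set.finite_range a).union (Set.finite_range b))
  let X : Plane → ℝ := fun p => p 0 + ε * p 1
  let Y : Plane → ℝ := fun p => p 1
  have hXY : ∀ p q, X p = X q → Y p = Y q → p = q := by
    intro p q h1 h2
    have h3 : p 1 = q 1 := h2
    have h4 : p 0 + ε * p 1 = q 0 + ε * q 1 := h1
    ext i
    fin_cases i
    · rw [h3] at h4
      exact add_right_cancel h4
    · exact h3
  -- `flip s` is true when the given direction from `a s` to `b s` points to the left, so that `(s,
  -- flip s)` starts at `a s`.
  let flip : S → Bool := fun s => decide (X (b s) < X (a s))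
  let L : S → Plane := fun s => bif flip s then b s else a s
  let R : S → Plane := fun s => bif flip s then a s else b s
  have hLR : ∀ s, (L s = a s ∧ R s = b s ∧ flip s = false) ∨
      (L s = b s ∧ R s = a s ∧ flip s = true) := by
    intro s
    cases h : flip s <;> simp [L, R, h]
  have hX : ∀ p ∈ Set.range a ∪ Set.range b, ∀ q ∈ Set.range a ∪ Set.range b,
    X p = X q → p = q := hε
  have ha : ∀ s, a s ∈ Set.range a ∪ Set.range b := fun s => Or.inl ⟨s, rfl⟩
  have hb : ∀ s, b s ∈ Set.range a ∪ Set.range b := fun s => Or.inr ⟨s, rfl⟩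
  have hL : ∀ s, L s ∈ Set.range a ∪ Set.range b := by
    intro s
    rcases hLR s with h | h
    · rw [h.1]; exact ha s
    · rw [h.1]; exact hb s
  have hR : ∀ s, R s ∈ Set.range a ∪ Set.range b := by
    intro s
    rcases hLR s with h | h
    · rw [h.2.1]; exact hb s
    · rw [h.2.1]; exact ha s
  have hlt : ∀ s, X (L s) < X (R s) := by
    intro s
    rcases hLR s with h | h
    · have h3 : ¬ X (b s) < X (a s) := of_decide_eq_false h.2.2
      rw [h.1, h.2.1]
      exact lt_of_le_of_ne (not_lt.1 h3) fun e => hne s (hX _ (ha s) _ (hb s) e)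
    · have h3 : X (b s) < X (a s) := of_decide_eq_true h.2.2
      rw [h.1, h.2.1]
      exact h3
  have hseg : ∀ s, segment ℝ (L s) (R s) = segment ℝ (a s) (b s) := by
    intro s
    rcases hLR s with h | h
    · rw [h.1, h.2.1]
    · rw [h.1, h.2.1, segment_symm]
  have hends : ∀ s z, (z = a s ∨ z = b s) → (X z = X (L s) ∨ X z = X (R s)) := by
    intro s z hz
    rcases hLR s with h | h
    · rw [h.1, h.2.1]
      exact hz.imp (congrArg X) (congrArg X)
    · rw [h.1, h.2.1]
      exact hz.symm.imp (congrArg X) (congrArg X)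
  have hpt : ∀ s α, X (L s) ≤ α → α ≤ X (R s) → ∃ z ∈ segment ℝ (L s) (R s), X z = α ∧
      Y z = Y (L s) + (Y (R s) - Y (L s)) / (X (R s) - X (L s)) * (α - X (L s)) := by
    intro s α h1 h2
    have h3 := hlt s
    have h4 : 0 < X (R s) - X (L s) := by linarith
    set θ := (α - X (L s)) / (X (R s) - X (L s)) with hθ
    have hθ0 : 0 ≤ θ := div_nonneg (by linarith) h4.le
    have hθ1 : θ ≤ 1 := by rw [hθ, div_le_one h4]; linarith
    have hθ2 : θ * (X (R s) - X (L s)) = α - X (L s) := by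
      rw [hθ]; field_simp
    refine ⟨(1 - θ) • L s + θ • R s, ⟨1 - θ, θ, by linarith, hθ0, by ring, rfl⟩, ?_, ?_⟩
    · have : X ((1 - θ) • L s + θ • R s) = X (L s) + θ * (X (R s) - X (L s)) := by
        simp only [X, PiLp.add_apply, PiLp.smul_apply, smul_eq_mul]
        ring
      rw [this, hθ2]; ring
    · have : Y ((1 - θ) • L s + θ • R s) = Y (L s) + θ * (Y (R s) - Y (L s)) := by
        simp only [Y, PiLp.add_apply, PiLp.smul_apply, smul_eq_mul]
        ring
      rw [this, hθ]; ring
  refine ⟨{ X := X, Y := Y, L := L, R := R, lt := hlt,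
            eq_LL := fun s t h => hX _ (hL s) _ (hL t) h
            eq_RR := fun s t h => hX _ (hR s) _ (hR t) h
            cross := ?_ }, flip, ?_⟩
  · intro s t hst α h1 h2 h3 h4 h5
    obtain ⟨z, hz, hzX, hzY⟩ := hpt s α h1 h2
    obtain ⟨w, hw, hwX, hwY⟩ := hpt t α h3 h4
    obtain rfl : z = w := hXY z w (hzX.trans hwX.symm) (by rw [hzY, hwY, h5])
    rw [hseg] at hz hw
    obtain ⟨e1, e2⟩ := hcross s t hst z hz hw
    rw [← hzX]
    exact ⟨hends s z e1, hends t z e2⟩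
  · intro s
    rcases hLR s with h | h
    · simp [SegmentFamily.base, h]
    · simp [SegmentFamily.base, h]

end SimpleGraph

/-! ### From a plane drawing to a rotation system with enough faces. -/

namespace SimpleGraph

variable {V : Type*} {G : SimpleGraph V}

/-- A plane drawing with a chosen direction and chosen bends for every edge. -/
structure PolygonalDrawing (G : SimpleGraph V) where
  pos : V → Plane
  pos_injective : Function.Injective pos
  out : G.edgeSet → G.Dart
  out_edge : ∀ e, (out e).edge = e
  arc : G.edgeSet → Set Plane
  len : G.edgeSet → ℕ
  bend : G.edgeSet → ℕ → Plane
  path : ∀ e, IsArcPath (pos (out e).fst) (pos (out e).snd) (arc e) (len e) (bend e)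
  vertex_on_arc : ∀ e w, pos w ∈ arc e → w ∈ (e : Sym2 V)
  arc_inter_arc : ∀ e f, e ≠ f → ∀ x ∈ arc e, x ∈ arc f →
    ∃ w, w ∈ (e : Sym2 V) ∧ w ∈ (f : Sym2 V) ∧ x = pos w

theorem PlaneDrawing.exists_polygonalDrawing (D : PlaneDrawing G) :
    Nonempty (PolygonalDrawing G) := by
  have h1 : ∀ e : G.edgeSet, ∃ d : G.Dart, d.edge = e := by
    rintro ⟨e, he⟩
    induction e with
    | _ u v => exact ⟨⟨(u, v), he⟩, rfl⟩
  choose out hout using h1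
  have h2 : ∀ e : G.edgeSet, ∃ n p,
      IsArcPath (D.pos (out e).fst) (D.pos (out e).snd) (D.arc e) n p := by
    intro e
    have := (D.isArc _ _ (out e).adj).exists_path
    rw [show s((out e).fst, (out e).snd) = (e : Sym2 V) from hout e] at this
    exact this
  choose len bend hpath using h2
  exact ⟨{ pos := D.pos
           pos_injective := D.pos_injective
           out := out
           out_edge := hout
           arc := fun e => D.arc e
           len := len
           bend := bend
           path := hpath
           vertex_on_arc := fun e w h => D.vertex_on_arc e e.2 w h
           arc_inter_arc := fun e f hef x hx hx' => D.arc_inter_arc e e.2 f f.2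
             (fun h => hef (Subtype.ext h)) x ⟨hx, hx'⟩ }⟩

namespace PolygonalDrawing

variable (P : PolygonalDrawing G)

/-- The straight pieces of the edges. -/
abbrev Seg : Type _ := Σ e : G.edgeSet, Fin (P.len e)

theorem mem_edge_iff (e : G.edgeSet) (w : V) :
    w ∈ (e : Sym2 V) ↔ w = (P.out e).fst ∨ w = (P.out e).snd := by
  rw [← P.out_edge e]
  exact Sym2.mem_iff

/-- Pieces of one edge meet as in an arc. Pieces of different edges meet only in a vertex, which is
an end of both arcs and hence of every piece through it. -/
theorem seg_cross (s t : P.Seg) (hst : s ≠ t) (z : Plane)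
    (hs : z ∈ segment ℝ (P.bend s.1 s.2) (P.bend s.1 (s.2 + 1)))
    (ht : z ∈ segment ℝ (P.bend t.1 t.2) (P.bend t.1 (t.2 + 1))) :
    (z = P.bend s.1 s.2 ∨ z = P.bend s.1 (s.2 + 1)) ∧
      (z = P.bend t.1 t.2 ∨ z = P.bend t.1 (t.2 + 1)) := by
  obtain ⟨e, i⟩ := s
  obtain ⟨f, j⟩ := t
  by_cases hef : e = f
  · subst hef
    refine (P.path e).inter_of_ne (fun h => hst ?_) i.2 j.2 hs ht
    rw [Fin.ext h]
  · obtain ⟨w, hwe, hwf, rfl⟩ := P.arc_inter_arc e f hef z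
      ((P.path e).segment_subset i.2 hs) ((P.path f).segment_subset j.2 ht)
    refine ⟨(P.path e).end_of_mem i.2 ?_ hs, (P.path f).end_of_mem j.2 ?_ ht⟩
    · exact ((P.mem_edge_iff e w).1 hwe).imp (congrArg P.pos) (congrArg P.pos)
    · exact ((P.mem_edge_iff f w).1 hwf).imp (congrArg P.pos) (congrArg P.pos)

/-- A vertex on an edge is the first or the last bend. -/
theorem bend_eq_pos {e : G.edgeSet} {j : ℕ} (hj : j ≤ P.len e) {v : V}
    (h : P.bend e j = P.pos v) :
    (j = 0 ∧ v = (P.out e).fst) ∨ (j = P.len e ∧ v = (P.out e).snd) := by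
  have hv := P.vertex_on_arc e v (by rw [← h]; exact (P.path e).mem hj)
  rcases (P.mem_edge_iff e v).1 hv with rfl | rfl
  · rw [← (P.path e).first] at h
    exact Or.inl ⟨(P.path e).eq_of_eq hj (Nat.zero_le _) h, rfl⟩
  · rw [← (P.path e).last] at h
    exact Or.inr ⟨(P.path e).eq_of_eq hj le_rfl h, rfl⟩

/-- A bend that is not a vertex belongs to a single edge. -/
theorem bend_eq_bend {e f : G.edgeSet} {i j : ℕ} (hi0 : 0 < i) (hi : i < P.len e)
    (hj : j ≤ P.len f) (h : P.bend e i = P.bend f j) : e = f ∧ i = j := by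
  by_cases hef : e = f
  · subst hef
    exact ⟨rfl, (P.path e).eq_of_eq hi.le hj h⟩
  · exfalso
    obtain ⟨w, -, -, hw⟩ := P.arc_inter_arc e f hef _ ((P.path e).mem hi.le)
      (by rw [h]; exact (P.path f).mem hj)
    rcases P.bend_eq_pos hi.le hw with h' | h' <;> omega

variable (F : SegmentFamily P.Seg Plane) (flip : P.Seg → Bool)

/-- The directed segment that starts at the bend `i`, in the chosen direction of the edge. -/
def fwd (e : G.edgeSet) (i : ℕ) (hi : i < P.len e) : P.Seg × Bool :=
  (⟨e, ⟨i, hi⟩⟩, flip ⟨e, ⟨i, hi⟩⟩)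

/-- The directed segment from the bend `i + 1` to the bend `i`. -/
def bwd (e : G.edgeSet) (i : ℕ) (hi : i < P.len e) : P.Seg × Bool :=
  (⟨e, ⟨i, hi⟩⟩, !flip ⟨e, ⟨i, hi⟩⟩)

theorem fwd_or_bwd (f : P.Seg × Bool) :
    (∃ e i, ∃ hi : i < P.len e, f = P.fwd flip e i hi) ∨
      ∃ e i, ∃ hi : i < P.len e, f = P.bwd flip e i hi := by
  obtain ⟨⟨e, i⟩, b⟩ := f
  by_cases h : b = flip ⟨e, i⟩
  · exact Or.inl ⟨e, i, i.2, by rw [h]; rfl⟩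
  · refine Or.inr ⟨e, i, i.2, ?_⟩
    rw [show b = !flip ⟨e, i⟩ by cases b <;> cases h' : flip ⟨e, i⟩ <;> simp_all]
    rfl

open Classical in
/-- The first directed segment of a dart. -/
noncomputable def start (d : G.Dart) : P.Seg × Bool :=
  if d = P.out ⟨d.edge, d.edge_mem⟩ then
    P.fwd flip ⟨d.edge, d.edge_mem⟩ 0 (P.path _).pos
  else
    P.bwd flip ⟨d.edge, d.edge_mem⟩ (P.len ⟨d.edge, d.edge_mem⟩ - 1)
      (Nat.sub_lt (P.path _).pos Nat.one_pos)

theorem start_out (e : G.edgeSet) : P.start flip (P.out e) = P.fwd flip e 0 (P.path e).pos := by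
  have h : (⟨(P.out e).edge, (P.out e).edge_mem⟩ : G.edgeSet) = e := Subtype.ext (P.out_edge e)
  unfold start
  simp only [h, if_true]

theorem start_out_symm (e : G.edgeSet) : P.start flip (P.out e).symm =
    P.bwd flip e (P.len e - 1) (Nat.sub_lt (P.path e).pos Nat.one_pos) := by
  have h : (⟨(P.out e).symm.edge, (P.out e).symm.edge_mem⟩ : G.edgeSet) = e :=
    Subtype.ext ((Dart.edge_symm _).trans (P.out_edge e))
  unfold start
  simp only [h, (P.out e).symm_ne, if_false]

theorem out_or_symm (d : G.Dart) : ∃ e : G.edgeSet, d.edge = e ∧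
    (d = P.out e ∨ d = (P.out e).symm) :=
  ⟨⟨d.edge, d.edge_mem⟩, rfl, (dart_edge_eq_iff _ _).1 (P.out_edge ⟨d.edge, d.edge_mem⟩).symm⟩

theorem start_injective : Function.Injective (P.start flip) := by
  intro d d' h
  obtain ⟨e, -, he⟩ := P.out_or_symm d
  obtain ⟨e', -, he'⟩ := P.out_or_symm d'
  have key : ∀ (e e' : G.edgeSet) i hi j hj, P.fwd flip e i hi ≠ P.bwd flip e' j hj := by
    intro e e' i hi j hj h
    have h1 := congrArg Prod.fst h
    have h2 := congrArg Prod.snd h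
    simp only [fwd, bwd] at h1 h2
    rw [h1] at h2
    cases h' : flip ⟨e', ⟨j, hj⟩⟩ <;> simp [h'] at h2
  rcases he with rfl | rfl <;> rcases he' with rfl | rfl <;>
    simp only [start_out, start_out_symm] at h
  · rw [show e = e' from congrArg (fun x => x.1.1) h]
  · exact absurd h (key _ _ _ _ _ _)
  · exact absurd h.symm (key _ _ _ _ _ _)
  · rw [show e = e' from congrArg (fun x => x.1.1) h]

theorem fwd_ne_bwd {e : G.edgeSet} {i : ℕ} (hi : i + 1 < P.len e) :
    P.fwd flip e (i + 1) hi ≠ P.bwd flip e i (Nat.lt_of_succ_lt hi) := by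
  intro h
  have h1 := congrArg (fun x => (x.1.2 : ℕ)) h
  simp only [fwd, bwd] at h1
  omega

section

variable (hF : ∀ s : P.Seg, F.base (s, flip s) = P.bend s.1 s.2 ∧
  F.base (s, !flip s) = P.bend s.1 (s.2 + 1))
include hF

theorem base_fwd {e : G.edgeSet} {i : ℕ} (hi : i < P.len e) :
    F.base (P.fwd flip e i hi) = P.bend e i := (hF _).1

theorem base_bwd {e : G.edgeSet} {i : ℕ} (hi : i < P.len e) :
    F.base (P.bwd flip e i hi) = P.bend e (i + 1) := (hF _).2

theorem base_start (d : G.Dart) : F.base (P.start flip d) = P.pos d.fst := by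
  obtain ⟨e, -, rfl | rfl⟩ := P.out_or_symm d
  · rw [start_out, P.base_fwd F flip hF, (P.path e).first]
  · have := (P.path e).pos
    rw [start_out_symm, P.base_bwd F flip hF, Nat.sub_add_cancel this, (P.path e).last]
    rfl

theorem exists_start {f : P.Seg × Bool} {v : V} (h : F.base f = P.pos v) :
    ∃ d : G.Dart, d.fst = v ∧ P.start flip d = f := by
  rcases P.fwd_or_bwd flip f with ⟨e, i, hi, rfl⟩ | ⟨e, i, hi, rfl⟩
  · rw [P.base_fwd F flip hF] at h
    rcases P.bend_eq_pos hi.le h with ⟨rfl, rfl⟩ | ⟨h', -⟩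
    · exact ⟨P.out e, rfl, P.start_out flip e⟩
    · omega
  · rw [P.base_bwd F flip hF] at h
    rcases P.bend_eq_pos hi h with ⟨h', -⟩ | ⟨h', rfl⟩
    · omega
    · refine ⟨(P.out e).symm, rfl, ?_⟩
      rw [start_out_symm]
      congr 1
      omega

theorem eq_of_base_eq_bend {f : P.Seg × Bool} {e : G.edgeSet} {i : ℕ} (hi : i + 1 < P.len e)
    (h : F.base f = P.bend e (i + 1)) :
    f = P.fwd flip e (i + 1) hi ∨ f = P.bwd flip e i (Nat.lt_of_succ_lt hi) := by
  rcases P.fwd_or_bwd flip f with ⟨e', j, hj, rfl⟩ | ⟨e', j, hj, rfl⟩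
  · rw [P.base_fwd F flip hF] at h
    obtain ⟨rfl, rfl⟩ := P.bend_eq_bend (Nat.succ_pos i) hi hj.le h.symm
    exact Or.inl rfl
  · rw [P.base_bwd F flip hF] at h
    obtain ⟨rfl, h'⟩ := P.bend_eq_bend (Nat.succ_pos i) hi hj h.symm
    obtain rfl : i = j := by omega
    exact Or.inr rfl

variable [Fintype V] [DecidableEq V] [DecidableRel G.Adj] (c : Sym2 V → ZMod 2)

/-- A sum over the directed segments at a vertex is a sum over the darts at the vertex. -/
theorem sum_base_eq_pos (v : V) (p : P.Seg × Bool → Prop) [DecidablePred p]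
    [DecidableEq Plane] :
    (∑ f : P.Seg × Bool, if F.base f = P.pos v ∧ p f then c f.1.1 else 0) =
      ∑ d : {d : G.Dart // d.fst = v},
        if p (P.start flip d) then c (d : G.Dart).edge else 0 := by
  classical
  symm
  refine Finset.sum_of_injOn (fun d : {d : G.Dart // d.fst = v} => P.start flip d)
    (fun d _ d' _ h => Subtype.ext (P.start_injective flip h)) (fun d _ => Finset.mem_coe.2
      (Finset.mem_univ _)) ?_ ?_
  · intro f _ hf
    rw [if_neg]
    rintro ⟨h, -⟩
    obtain ⟨d, hd, rfl⟩ := P.exists_start F flip hF h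
    exact hf ⟨⟨d, hd⟩, Finset.mem_coe.2 (Finset.mem_univ _), rfl⟩
  · rintro ⟨d, rfl⟩ _
    have hb := P.base_start F flip hF d
    have he : ((P.start flip d).1.1 : Sym2 V) = d.edge := by
      unfold start
      split_ifs <;> rfl
    simp only [hb, true_and, he]

/-- At a vertex this is the cycle condition; at an inner bend the two pieces of one edge contribute
the same value twice; no other point starts a piece. -/
theorem even_at_base [DecidableEq Plane]
    (hc : ∀ v, ∑ d : {d : G.Dart // d.fst = v}, c (d : G.Dart).edge = 0) (q : Plane) :
    ∑ f : P.Seg × Bool, (if F.base f = q then c f.1.1 else 0) = 0 := by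
  classical
  by_cases hq : ∃ v, q = P.pos v
  · obtain ⟨v, rfl⟩ := hq
    have := P.sum_base_eq_pos F flip hF c v (fun _ => True)
    simp only [and_true, if_true] at this
    rw [this, hc]
  by_cases hq' : ∃ e i, ∃ hi : i + 1 < P.len e, q = P.bend e (i + 1)
  · obtain ⟨e, i, hi, rfl⟩ := hq'
    rw [Finset.sum_eq_add _ _ (P.fwd_ne_bwd flip hi)]
    · rw [if_pos (P.base_fwd F flip hF hi), if_pos (P.base_bwd F flip hF _)]
      exact CharTwo.add_self_eq_zero _
    · intro f _ hf
      rw [if_neg]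
      intro h
      rcases P.eq_of_base_eq_bend F flip hF hi h with h | h
      · exact hf.1 h
      · exact hf.2 h
    · simp
    · simp
  · refine Finset.sum_eq_zero fun f _ => if_neg fun h => ?_
    rcases P.fwd_or_bwd flip f with ⟨e, i, hi, rfl⟩ | ⟨e, i, hi, rfl⟩
    · rw [P.base_fwd F flip hF] at h
      rcases Nat.eq_zero_or_pos i with rfl | hi0
      · exact hq ⟨_, by rw [← h, (P.path e).first]⟩
      · obtain ⟨k, rfl⟩ : ∃ k, i = k + 1 := ⟨i - 1, by omega⟩
        exact hq' ⟨e, k, hi, h.symm⟩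
    · rw [P.base_bwd F flip hF] at h
      rcases (Nat.succ_le_of_lt hi).eq_or_lt with h' | h'
      · refine hq ⟨(P.out e).snd, ?_⟩
        rw [← h, ← (P.path e).last, ← h']
      · exact hq' ⟨e, i, h', h.symm⟩

/-- The left parity is carried along the edge. At each inner bend, turning from the backward to the
forward piece changes it by `c e`, as does reversing a piece, so all forward pieces have the same
parity. The last one is reversed to reach the other end. -/
theorem leftParity_start_add
    (hc : ∀ v, ∑ d : {d : G.Dart // d.fst = v}, c (d : G.Dart).edge = 0) (d : G.Dart) :
    F.leftParity (fun s => c s.1) (P.start flip d) +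
      F.leftParity (fun s => c s.1) (P.start flip d.symm) = c d.edge := by
  classical
  have hev : ∀ q, ∑ f : P.Seg × Bool,
      (@ite _ (F.base f = q) (Classical.propDecidable _) (c f.1.1) 0) = 0 := by
    intro q
    refine Eq.trans ?_ (P.even_at_base F flip hF c hc q)
    exact Finset.sum_congr rfl fun f _ => by congr
  have hout : ∀ e, F.leftParity (fun s => c s.1) (P.start flip (P.out e)) +
      F.leftParity (fun s => c s.1) (P.start flip (P.out e).symm) = c e := by
    intro e
    have hturn : ∀ i (hi : i < P.len e), F.leftParity (fun s => c s.1) (P.fwd flip e i hi) +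
        F.leftParity (fun s => c s.1) (P.bwd flip e i hi) = c e := fun i hi =>
      F.leftParity_add_reverse hev _ _
    have hconst : ∀ i (hi : i < P.len e), F.leftParity (fun s => c s.1) (P.fwd flip e i hi) =
        F.leftParity (fun s => c s.1) (P.fwd flip e 0 (P.path e).pos) := by
      intro i
      induction i with
      | zero => intro _; rfl
      | succ i ih =>
        intro hi
        have hi' : i < P.len e := Nat.lt_of_succ_lt hi
        rw [← ih hi']
        have h1 := F.leftParity_add_of_pair (c := fun s => c s.1) (P.fwd_ne_bwd flip hi)
          (by rw [P.base_fwd F flip hF, P.base_bwd F flip hF])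
          (fun f hf => P.eq_of_base_eq_bend F flip hF hi
            (by rw [hf, P.base_fwd F flip hF])) rfl
        exact add_right_cancel (h1.trans (hturn i hi').symm)
    rw [start_out, start_out_symm, ← hconst _ (Nat.sub_lt (P.path e).pos Nat.one_pos)]
    exact hturn _ _
  obtain ⟨e, he, rfl | rfl⟩ := P.out_or_symm d
  · rw [hout e, he]
  · rw [Dart.symm_symm, add_comm, hout e, he]

end

/-- Euler's formula, as an inequality, for the rotation system of a plane drawing. -/
theorem exists_rotationSystem (P : PolygonalDrawing G) [Fintype V] [DecidableEq V] [Nonempty V] [DecidableRel G.Adj] :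
    ∃ ρ : G.RotationSystem, G.edgeFinset.card + 1 ≤
      Fintype.card V + Nat.card (Quotient (Equiv.Perm.SameCycle.setoid ρ.face)) := by
  classical
  obtain ⟨F, flip, hF⟩ := exists_segmentFamily (fun s : P.Seg => P.bend s.1 s.2)
    (fun s => P.bend s.1 (s.2 + 1)) (fun s => (P.path s.1).ne s.2 s.2.2) P.seg_cross
  have hrot := fun v => exists_cyclic_successor
    (fun d : {d : G.Dart // d.fst = v} => F.key (P.start flip d)) (by
      intro d d' h
      refine Subtype.ext (P.start_injective flip (F.key_injOn ?_ h))
      rw [P.base_start F flip hF, P.base_start F flip hF, d.2, d'.2])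
  choose τ hτ1 hτ2 using hrot
  -- The cyclic orders `τ v` at the single vertices are assembled into one permutation of all darts.
  let E := Equiv.sigmaFiberEquiv (fun d : G.Dart => d.fst)
  let σ : Equiv.Perm G.Dart := (E.symm.trans (Equiv.Perm.sigmaCongrRight τ)).trans E
  have hσ : ∀ v (d : {d : G.Dart // d.fst = v}), σ d = τ v d := by
    rintro v ⟨d, rfl⟩
    rfl
  have hσ' : ∀ v (k : ℤ) (d : {d : G.Dart // d.fst = v}), (σ ^ k) d = (τ v ^ k) d := by
    intro v k
    induction k using Int.induction_on with
    | zero => simp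
    | succ k ih =>
      intro d
      rw [zpow_add_one, zpow_add_one, Equiv.Perm.mul_apply, Equiv.Perm.mul_apply, hσ, ih]
    | pred k ih =>
      intro d
      have : σ⁻¹ d = ((τ v)⁻¹ d : {d : G.Dart // d.fst = v}) := by
        rw [Equiv.Perm.inv_eq_iff_eq, hσ, ← Equiv.Perm.mul_apply, mul_inv_cancel,
          Equiv.Perm.one_apply]
      rw [zpow_sub_one, zpow_sub_one, Equiv.Perm.mul_apply, Equiv.Perm.mul_apply, this, ih]
  let ρ : G.RotationSystem :=
    { rot := σ
      rot_fst := fun d => by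
        rw [hσ d.fst ⟨d, rfl⟩]
        exact (τ d.fst ⟨d, rfl⟩).2
      sameCycle := by
        intro d d' h
        obtain ⟨k, hk⟩ := hτ1 d'.fst ⟨d, h⟩ ⟨d', rfl⟩
        exact ⟨k, by rw [hσ' d'.fst k ⟨d, h⟩, hk]⟩ }
  refine ⟨ρ, euler_of_cycle_space_le ρ.face fun c hc => ?_⟩
  have hc' : ∀ v, ∑ d : {d : G.Dart // d.fst = v}, c (d : G.Dart).edge = 0 := by
    intro v
    rw [← hc v, ← Finset.sum_filter]
    exact (Finset.sum_subtype _ (by simp) fun d : G.Dart => c d.edge).symm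
  have hadd := P.leftParity_start_add F flip hF c hc'
  refine ⟨fun d => F.leftParity (fun s => c s.1) (P.start flip d), ?_, hadd⟩
  have hrotate : ∀ d, F.leftParity (fun s => c s.1) (P.start flip (σ d)) =
      F.leftParity (fun s => c s.1) (P.start flip d) + c (σ d).edge := by
    intro d
    have hval : ∀ d' : {d' : G.Dart // d'.fst = d.fst},
        F.leftParity (fun s => c s.1) (P.start flip d') =
        F.belowParity (fun s => c s.1) (P.pos d.fst) +
          ∑ b : {d' : G.Dart // d'.fst = d.fst},
            if F.key (P.start flip b) ≤ F.key (P.start flip d') then c (b : G.Dart).edge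
            else 0 := by
      intro d'
      unfold SegmentFamily.leftParity
      rw [P.base_start F flip hF, d'.2]
      congr 1
      rw [← P.sum_base_eq_pos F flip hF c d.fst
        (fun f => F.key f ≤ F.key (P.start flip d'))]
      exact Finset.sum_congr rfl fun f _ => by congr
    have h1 := hτ2 d.fst (fun d' => c (d' : G.Dart).edge) (hc' d.fst) ⟨d, rfl⟩
    rw [hσ d.fst ⟨d, rfl⟩, hval, hval ⟨d, rfl⟩, h1, add_assoc]
  intro d
  -- The next dart of the face is `σ⁻¹ d.symm`. Rotating it to `d.symm` and then reversing to `d`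
  -- changes the parity by `c d.edge` twice.
  have h1 := hrotate (σ⁻¹ d.symm)
  have h2 := hadd d
  have h3 : σ (σ⁻¹ d.symm) = d.symm := by
    rw [← Equiv.Perm.mul_apply, mul_inv_cancel, Equiv.Perm.one_apply]
  rw [h3, Dart.edge_symm] at h1
  change F.leftParity (fun s => c s.1) (P.start flip (σ⁻¹ d.symm)) =
    F.leftParity (fun s => c s.1) (P.start flip d)
  rw [h1, add_left_comm] at h2
  generalize F.leftParity (fun s => c s.1) (P.start flip d) = x at *
  generalize F.leftParity (fun s => c s.1) (P.start flip (σ⁻¹ d.symm)) = y at *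
  linear_combination h2 - CharTwo.add_self_eq_zero x

end PolygonalDrawing

end SimpleGraph

/-! ### Triangular faces, corners and the initial charge. -/

namespace SimpleGraph

namespace RotationSystem

variable {V : Type*} {G : SimpleGraph V} (ρ : G.RotationSystem)

theorem rot_inv_fst (d : G.Dart) : (ρ.rot⁻¹ d).fst = d.fst := by
  have := ρ.rot_fst (ρ.rot⁻¹ d)
  rw [← Equiv.Perm.mul_apply, mul_inv_cancel, Equiv.Perm.one_apply] at this
  exact this.symm

theorem rot_rot_inv (d : G.Dart) : ρ.rot (ρ.rot⁻¹ d) = d := by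
  rw [← Equiv.Perm.mul_apply, mul_inv_cancel, Equiv.Perm.one_apply]

theorem rot_inv_rot (d : G.Dart) : ρ.rot⁻¹ (ρ.rot d) = d := by
  rw [← Equiv.Perm.mul_apply, inv_mul_cancel, Equiv.Perm.one_apply]

theorem face_fst (d : G.Dart) : (ρ.face d).fst = d.snd := ρ.rot_inv_fst d.symm

/-- A set of darts at a vertex that is closed under rotation contains all darts there. -/
theorem of_closed {p : G.Dart → Prop} {d : G.Dart} (hd : p d)
    (h : ∀ e, e.fst = d.fst → p e → p (ρ.rot e)) [Finite G.Dart] {d' : G.Dart}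
    (hd' : d'.fst = d.fst) : p d' := by
  obtain ⟨n, hn⟩ := (ρ.sameCycle d d' hd'.symm).exists_nat_pow_eq
  have key : ∀ n : ℕ, p ((ρ.rot ^ n) d) ∧ ((ρ.rot ^ n) d).fst = d.fst := by
    intro n
    induction n with
    | zero => exact ⟨hd, rfl⟩
    | succ n ih =>
      rw [pow_succ', Equiv.Perm.mul_apply]
      exact ⟨h _ ih.2 ih.1, (ρ.rot_fst _).trans ih.2⟩
  rw [← hn]
  exact (key n).1

open Classical in
/-- `0` for the darts of triangular faces and `1` for all others. -/
noncomputable def nontri (d : G.Dart) : ℚ :=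
  if (ρ.face ^ 3) d = d then 0 else 1

theorem nontri_nonneg (d : G.Dart) : 0 ≤ ρ.nontri d := by
  unfold nontri; split_ifs <;> norm_num

theorem nontri_le_one (d : G.Dart) : ρ.nontri d ≤ 1 := by
  unfold nontri; split_ifs <;> norm_num

theorem nontri_face (d : G.Dart) : ρ.nontri (ρ.face d) = ρ.nontri d := by
  have : (ρ.face ^ 3) (ρ.face d) = ρ.face d ↔ (ρ.face ^ 3) d = d := by
    rw [← Equiv.Perm.mul_apply, ← pow_succ, pow_succ', Equiv.Perm.mul_apply,
      ρ.face.injective.eq_iff]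
  classical
  unfold nontri
  exact if_congr this rfl rfl

/-- The face on the right of a dart is the face on the left of its predecessor in the rotation. -/
theorem nontri_symm (d : G.Dart) : ρ.nontri d.symm = ρ.nontri (ρ.rot⁻¹ d) := by
  rw [← ρ.nontri_face d.symm, face_apply, Dart.symm_symm]

/-- The face on the left of `d` lies between `d` and `rot d`. If it is a triangle, its third side
joins the ends of these two darts. -/
theorem nontri_eq (d : G.Dart) :
    ρ.nontri d = 1 ∨ ρ.nontri d = 0 ∧ G.Adj d.snd (ρ.rot d).snd := by
  unfold nontri
  split_ifs with h
  · refine Or.inr ⟨rfl, ?_⟩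
    rw [pow_succ', pow_succ', pow_one, Equiv.Perm.mul_apply, Equiv.Perm.mul_apply] at h
    have h1 := (ρ.face d).adj
    have h2 : (ρ.face (ρ.face d)).symm = ρ.rot d := by
      rw [← h, face_apply ρ (ρ.face (ρ.face d)), rot_rot_inv]
      rw [← face_apply, h]
    have h3 : (ρ.rot d).snd = (ρ.face d).snd := by
      rw [← h2]
      exact ρ.face_fst _
    rw [h3, ← ρ.face_fst d]
    exact h1
  · exact Or.inl rfl

theorem nontri_symm_eq (d : G.Dart) :
    ρ.nontri d.symm = 1 ∨ ρ.nontri d.symm = 0 ∧ G.Adj d.snd (ρ.rot⁻¹ d).snd := by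
  rw [nontri_symm]
  refine (ρ.nontri_eq (ρ.rot⁻¹ d)).imp id fun h => ⟨h.1, ?_⟩
  have := h.2
  rw [rot_rot_inv] at this
  exact this.symm

theorem face_ne (d : G.Dart) : ρ.face d ≠ d := by
  intro h
  have := ρ.face_fst d
  rw [h] at this
  exact d.adj.ne this

variable [Fintype V] [DecidableEq V] [DecidableRel G.Adj]

variable (G) in
/-- The darts that start at a vertex. -/
def dartsAt (v : V) : Finset G.Dart := {d | d.fst = v}

omit ρ in
theorem mem_dartsAt {v : V} {d : G.Dart} : d ∈ dartsAt G v ↔ d.fst = v := by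
  simp [dartsAt]

omit ρ in
theorem card_dartsAt (v : V) : (dartsAt G v).card = G.degree v := by
  rw [← G.dart_fst_fiber_card_eq_degree v]
  rfl

omit ρ in
theorem dart_ext_of_mem {v : V} {d d' : G.Dart} (h : d ∈ dartsAt G v) (h' : d' ∈ dartsAt G v)
    (hs : d.snd = d'.snd) : d = d' :=
  Dart.ext _ _ (Prod.ext ((mem_dartsAt.1 h).trans (mem_dartsAt.1 h').symm) hs)

omit ρ in
theorem card_filter_dartsAt (v : V) (p : V → Prop) [DecidablePred p] :
    ((dartsAt G v).filter fun d => p d.snd).card = ((G.neighborFinset v).filter p).card := by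
  refine Finset.card_bij (fun d _ => d.snd) ?_ ?_ ?_
  · intro d hd
    rw [Finset.mem_filter, mem_dartsAt] at hd
    rw [Finset.mem_filter, mem_neighborFinset]
    exact ⟨hd.1 ▸ d.adj, hd.2⟩
  · intro d hd d' hd' h
    exact dart_ext_of_mem (Finset.mem_filter.1 hd).1 (Finset.mem_filter.1 hd').1 h
  · intro w hw
    rw [Finset.mem_filter, mem_neighborFinset] at hw
    exact ⟨⟨(v, w), hw.1⟩, Finset.mem_filter.2 ⟨mem_dartsAt.2 rfl, hw.2⟩, rfl⟩

omit ρ in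
theorem adj_of_mem {v : V} {d : G.Dart} (h : d ∈ dartsAt G v) : G.Adj v d.snd :=
  mem_dartsAt.1 h ▸ d.adj

theorem rot_mem {v : V} {d : G.Dart} (h : d ∈ dartsAt G v) : ρ.rot d ∈ dartsAt G v :=
  mem_dartsAt.2 ((ρ.rot_fst d).trans (mem_dartsAt.1 h))

theorem rot_inv_mem {v : V} {d : G.Dart} (h : d ∈ dartsAt G v) : ρ.rot⁻¹ d ∈ dartsAt G v :=
  mem_dartsAt.2 ((ρ.rot_inv_fst d).trans (mem_dartsAt.1 h))

theorem sum_rot {M : Type*} [AddCommMonoid M] (v : V) (f : G.Dart → M) :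
    ∑ d ∈ dartsAt G v, f (ρ.rot d) = ∑ d ∈ dartsAt G v, f d :=
  Finset.sum_bij' (fun d _ => ρ.rot d) (fun d _ => ρ.rot⁻¹ d) (fun _ => ρ.rot_mem)
    (fun _ => ρ.rot_inv_mem) (fun d _ => ρ.rot_inv_rot d) (fun d _ => ρ.rot_rot_inv d)
    (fun _ _ => rfl)

theorem sum_rot_inv {M : Type*} [AddCommMonoid M] (v : V) (f : G.Dart → M) :
    ∑ d ∈ dartsAt G v, f (ρ.rot⁻¹ d) = ∑ d ∈ dartsAt G v, f d := by
  rw [← ρ.sum_rot v fun d => f (ρ.rot⁻¹ d)]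
  simp only [rot_inv_rot]

theorem sum_nontri_symm (v : V) :
    ∑ d ∈ dartsAt G v, ρ.nontri d.symm = ∑ d ∈ dartsAt G v, ρ.nontri d := by
  simp only [nontri_symm]
  exact ρ.sum_rot_inv v _

theorem rot_ne (d : G.Dart) (h : 2 ≤ G.degree d.fst) : ρ.rot d ≠ d := by
  intro he
  rw [← card_dartsAt] at h
  obtain ⟨a, ha, b, hb, hab⟩ := Finset.one_lt_card.1 h
  have key : ∀ e ∈ dartsAt G d.fst, e = d := fun e hm =>
    ρ.of_closed (p := fun e => e = d) rfl (fun e _ h => by rw [h, he]) (mem_dartsAt.1 hm)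
  exact hab ((key a ha).trans (key b hb).symm)

theorem rot_ne_rot_inv (d : G.Dart) (h : 3 ≤ G.degree d.fst) : ρ.rot d ≠ ρ.rot⁻¹ d := by
  intro he
  rw [← card_dartsAt] at h
  have h2 : ρ.rot (ρ.rot d) = d := by rw [he, rot_rot_inv]
  have key : dartsAt G d.fst ⊆ {d, ρ.rot d} := by
    intro e hm
    have : e = d ∨ e = ρ.rot d :=
      ρ.of_closed (p := fun e => e = d ∨ e = ρ.rot d) (d := d) (Or.inl rfl) (by
        rintro e - (rfl | rfl)
        · exact Or.inr rfl
        · exact Or.inl h2) (mem_dartsAt.1 hm)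
    simpa using this
  have := (Finset.card_le_card key).trans Finset.card_le_two
  omega

/-- A face of length 2 would make the rotation fix a dart, that is, give a vertex of degree 1. -/
theorem face_face_ne (h : ∀ v, 2 ≤ G.degree v) (d : G.Dart) : ρ.face (ρ.face d) ≠ d := by
  intro he
  have h1 : (ρ.face d).snd = d.fst := by rw [← ρ.face_fst (ρ.face d), he]
  have h2 : ρ.face d = d.symm := Dart.ext _ _ (Prod.ext (ρ.face_fst d) h1)
  rw [face_apply, Equiv.Perm.inv_eq_iff_eq] at h2
  exact ρ.rot_ne d.symm (h _) h2.symm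

/-- Each dart of a triangle counts 2, each dart of any other face 3/2. No face has length 1 or 2, so
there are three darts of the first kind or at least four of the second. -/
theorem charge_face (h : ∀ v, 2 ≤ G.degree v)
    (q : Quotient (Equiv.Perm.SameCycle.setoid ρ.face)) [DecidableEq
      (Quotient (Equiv.Perm.SameCycle.setoid ρ.face))] :
    6 ≤ ∑ d : G.Dart with Quotient.mk (Equiv.Perm.SameCycle.setoid ρ.face) d = q,
      (2 - ρ.nontri d / 2) := by
  induction q using Quotient.inductionOn with
  | h d =>
  have hmem : ∀ k : ℕ, (ρ.face ^ k) d ∈ (Finset.univ.filter fun e : G.Dart =>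
      Quotient.mk (Equiv.Perm.SameCycle.setoid ρ.face) e = Quotient.mk _ d) := by
    intro k
    rw [Finset.mem_filter]
    refine ⟨Finset.mem_univ _, Quotient.sound ?_⟩
    exact Equiv.Perm.SameCycle.symm ⟨k, by rw [zpow_natCast]⟩
  have hd0 := hmem 0
  have hd1 := hmem 1
  have hd2 := hmem 2
  have hd3 := hmem 3
  have e2 : (ρ.face ^ 2) d = ρ.face (ρ.face d) := by
    rw [pow_succ', pow_one, Equiv.Perm.mul_apply]
  have e3 : (ρ.face ^ 3) d = ρ.face (ρ.face (ρ.face d)) := by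
    rw [pow_succ', Equiv.Perm.mul_apply, e2]
  rw [pow_zero, Equiv.Perm.one_apply] at hd0
  rw [pow_one] at hd1
  rw [e2] at hd2
  rw [e3] at hd3
  have n01 := ρ.face_ne d
  have n12 := ρ.face_ne (ρ.face d)
  have n23 := ρ.face_ne (ρ.face (ρ.face d))
  have n02 := ρ.face_face_ne h d
  have n13 := ρ.face_face_ne h (ρ.face d)
  have hnn : ∀ e : G.Dart, 3 / 2 ≤ 2 - ρ.nontri e / 2 := by
    intro e
    have := ρ.nontri_le_one e
    linarith
  by_cases htri : (ρ.face ^ 3) d = d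
  · have hN : ρ.nontri d = 0 := if_pos htri
    have hsub : ({d, ρ.face d, ρ.face (ρ.face d)} : Finset G.Dart) ⊆
        (Finset.univ.filter fun e : G.Dart =>
          Quotient.mk (Equiv.Perm.SameCycle.setoid ρ.face) e = Quotient.mk _ d) := by
      intro e he
      simp only [Finset.mem_insert, Finset.mem_singleton] at he
      rcases he with rfl | rfl | rfl <;> assumption
    refine le_trans ?_ (Finset.sum_le_sum_of_subset_of_nonneg hsub fun e _ _ => by
      have := hnn e; linarith)
    rw [Finset.sum_insert, Finset.sum_insert, Finset.sum_singleton]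
    · simp only [nontri_face, hN]
      norm_num
    · simpa using n12.symm
    · simp only [Finset.mem_insert, Finset.mem_singleton, not_or]
      exact ⟨n01.symm, n02.symm⟩
  · rw [e3] at htri
    have hsub : ({d, ρ.face d, ρ.face (ρ.face d), ρ.face (ρ.face (ρ.face d))} :
        Finset G.Dart) ⊆ (Finset.univ.filter fun e : G.Dart =>
          Quotient.mk (Equiv.Perm.SameCycle.setoid ρ.face) e = Quotient.mk _ d) := by
      intro e he
      simp only [Finset.mem_insert, Finset.mem_singleton] at he
      rcases he with rfl | rfl | rfl | rfl <;> assumption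
    refine le_trans ?_ (Finset.sum_le_sum_of_subset_of_nonneg hsub fun e _ _ => by
      have := hnn e; linarith)
    have hcard : ({d, ρ.face d, ρ.face (ρ.face d), ρ.face (ρ.face (ρ.face d))} :
        Finset G.Dart).card = 4 := by
      rw [Finset.card_insert_of_notMem, Finset.card_insert_of_notMem,
        Finset.card_insert_of_notMem, Finset.card_singleton]
      · simpa using n23.symm
      · simp only [Finset.mem_insert, Finset.mem_singleton, not_or]
        exact ⟨n12.symm, n13.symm⟩
      · simp only [Finset.mem_insert, Finset.mem_singleton, not_or]
        exact ⟨n01.symm, n02.symm, Ne.symm htri⟩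
    have := Finset.card_nsmul_le_sum
      ({d, ρ.face d, ρ.face (ρ.face d), ρ.face (ρ.face (ρ.face d))} : Finset G.Dart) (fun e => 2 - ρ.nontri e / 2) (3 / 2) fun e _ =>
      (hnn e)
    rw [hcard] at this
    refine le_trans ?_ this
    norm_num

/-- Euler's formula in the form used for discharging: every vertex `v` has charge `deg v - 6`, and
every corner of a face that is not a triangle has charge `1 / 2`. -/
theorem total_charge (h : ∀ v, 2 ≤ G.degree v)
    (heuler : G.edgeFinset.card + 1 ≤
      Fintype.card V + Nat.card (Quotient (Equiv.Perm.SameCycle.setoid ρ.face))) :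
    ∑ v, ((G.degree v : ℚ) - 6) + (∑ d, ρ.nontri d) / 2 ≤ -6 := by
  classical
  let Q := Quotient (Equiv.Perm.SameCycle.setoid ρ.face)
  let _ : Fintype Q := Fintype.ofFinite Q
  have h1 : 6 * (Nat.card Q : ℚ) ≤ ∑ d : G.Dart, (2 - ρ.nontri d / 2) := by
    rw [← Finset.sum_fiberwise Finset.univ
      (fun d : G.Dart => Quotient.mk (Equiv.Perm.SameCycle.setoid ρ.face) d)]
    rw [Nat.card_eq_fintype_card, mul_comm, ← nsmul_eq_mul]
    exact Finset.card_nsmul_le_sum Finset.univ _ 6 fun q _ => ρ.charge_face h q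
  have h2 : ((Fintype.card G.Dart : ℕ) : ℚ) = 2 * G.edgeFinset.card := by
    rw [G.dart_card_eq_twice_card_edges]; push_cast; rfl
  have h3 : ∑ v, (G.degree v : ℚ) = 2 * G.edgeFinset.card := by
    rw [← Nat.cast_sum, G.sum_degrees_eq_twice_card_edges]; push_cast; rfl
  have h4 : (G.edgeFinset.card : ℚ) + 1 ≤ Fintype.card V + Nat.card Q := by
    exact_mod_cast heuler
  rw [Finset.sum_sub_distrib, ← Finset.sum_div, Finset.sum_const, Finset.card_univ,
    nsmul_eq_mul, h2] at h1
  rw [Finset.sum_sub_distrib, h3, Finset.sum_const, Finset.card_univ, nsmul_eq_mul]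
  linarith

end RotationSystem

end SimpleGraph

/-! ### Discharging rules, and the charge sent by vertices of degree 8, 9, 10 and at least 12. -/

namespace SimpleGraph

set_option linter.unusedSectionVars false

open RotationSystem

/-- The local conditions under which the discharging argument works. Here `D v` is the degree of
`v` in a larger graph, where it may have further neighbours if its degree is large. -/
structure ConfigFree {V : Type*} [Fintype V] (G : SimpleGraph V) [DecidableRel G.Adj]
    (D : V → ℕ) : Prop where
  three_le : ∀ v, 3 ≤ G.degree v
  -- The second alternative describes vertices that had neighbours of degree 2. They have at least
  -- eight neighbours with `D` above 8.
  degree_eq : ∀ v, G.degree v = D v ∨ 9 ≤ G.degree v ∧ 9 ≤ D v ∧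
    ((G.neighborFinset v).filter fun w => D w ≤ 8).card + 8 ≤ G.degree v
  three_adj : ∀ u v, D u = 3 → G.Adj u v → 9 ≤ D v
  three_nine : ∀ u v w, D u = 3 → D v = 9 → G.Adj u v → G.Adj u w → ¬ G.Adj v w
  three_ten : ∀ u v w x, D u = 3 → D v = 10 → G.Adj u v → w ≠ x → G.Adj u w → G.Adj v w →
    G.Adj u x → G.Adj v x → ((G.neighborFinset v).filter fun w => D w ≤ 5).card ≤ 4
  four : ∀ v u w, D v = 4 → G.Adj v u → G.Adj v w → u ≠ w → D u ≤ 7 → 18 ≤ D u + D w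
  five : ∀ v x y z, D v = 5 → G.Adj v x → G.Adj v y → G.Adj v z → x ≠ y → x ≠ z → y ≠ z →
    19 ≤ D x + D y + D z
  five_six_seven : ∀ v, D v = 5 → (∀ w, G.Adj v w → D w = 6 ∨ D w = 7) →
    ((G.neighborFinset v).filter fun w => D w = 6).card = 2 →
    ∀ x y, G.Adj v x → G.Adj v y → D x = 6 → D y = 7 → ¬ G.Adj x y

namespace ConfigFree

variable {V : Type*} [Fintype V] [DecidableEq V] {G : SimpleGraph V} [DecidableRel G.Adj]
  {D : V → ℕ} (h : ConfigFree G D) (ρ : G.RotationSystem)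

/-- The number of faces at an edge that are not triangles. -/
noncomputable def sides (d : G.Dart) : ℚ := ρ.nontri d + ρ.nontri d.symm

open Classical in
variable (D) in
/-- The charge that `d.fst` sends to `d.snd`. -/
noncomputable def give (d : G.Dart) : ℚ :=
  -- Together with the `sides ρ d / 4` that a 3-vertex gets from the faces, each of its three edges
  -- brings exactly 1.
  if D d.snd = 3 then 1 - sides ρ d / 4
  else if D d.snd = 4 then
    if 8 ≤ D d.fst then (if ∃ w, G.Adj d.snd w ∧ D w ≤ 7 then 2 / 3 else 1 / 2) else 0
  else if D d.snd = 5 then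
    if 8 ≤ D d.fst then (if ∀ w, G.Adj d.snd w → 6 ≤ D w then 1 / 2 else 1 / 3)
    else if D d.fst = 7 then 1 / 4 else 0
  else 0

theorem sides_symm (d : G.Dart) : sides ρ d.symm = sides ρ d := by
  unfold sides; rw [Dart.symm_symm, add_comm]

theorem sides_nonneg (d : G.Dart) : 0 ≤ sides ρ d :=
  add_nonneg (ρ.nontri_nonneg _) (ρ.nontri_nonneg _)

theorem sides_le (d : G.Dart) : sides ρ d ≤ 2 := by
  have h1 := ρ.nontri_le_one d
  have h2 := ρ.nontri_le_one d.symm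
  unfold sides; linarith

theorem give_nonneg (d : G.Dart) : 0 ≤ give D ρ d := by
  have := sides_le ρ d
  unfold give
  split_ifs <;> linarith

theorem give_le_one (d : G.Dart) : give D ρ d ≤ 1 := by
  have := sides_nonneg ρ d
  unfold give
  split_ifs <;> linarith

theorem give_eq_zero_of_six_le {d : G.Dart} (hd : 6 ≤ D d.snd) : give D ρ d = 0 := by
  unfold give
  rw [if_neg (by omega), if_neg (by omega), if_neg (by omega)]

theorem give_three {d : G.Dart} (hd : D d.snd = 3) : give D ρ d = 1 - sides ρ d / 4 := by
  unfold give
  rw [if_pos hd]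

open Classical in
theorem give_four {d : G.Dart} (hd : D d.snd = 4) (hv : 8 ≤ D d.fst) : give D ρ d =
    if ∃ w, G.Adj d.snd w ∧ D w ≤ 7 then 2 / 3 else 1 / 2 := by
  unfold give
  rw [if_neg (by omega), if_pos hd, if_pos hv]

open Classical in
theorem give_five {d : G.Dart} (hd : D d.snd = 5) (hv : 8 ≤ D d.fst) : give D ρ d =
    if ∀ w, G.Adj d.snd w → 6 ≤ D w then 1 / 2 else 1 / 3 := by
  unfold give
  rw [if_neg (by omega), if_neg (by omega), if_pos hd, if_pos hv]

theorem give_five_seven {d : G.Dart} (hd : D d.snd = 5) (hv : D d.fst = 7) :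
    give D ρ d = 1 / 4 := by
  unfold give
  rw [if_neg (by omega), if_neg (by omega), if_pos hd, if_neg (by omega), if_pos hv]

theorem sum_sides (v : V) :
    ∑ d ∈ dartsAt G v, sides ρ d = 2 * ∑ d ∈ dartsAt G v, ρ.nontri d := by
  unfold sides
  rw [Finset.sum_add_distrib, ρ.sum_nontri_symm]
  ring

/-- `1` if the end of the dart has degree at least 6, and `0` otherwise. -/
def big (D : V → ℕ) (d : G.Dart) : ℚ := if 6 ≤ D d.snd then 1 else 0

theorem big_nonneg (d : G.Dart) : 0 ≤ big D d := by
  unfold big; split_ifs <;> norm_num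

theorem big_eq_one {d : G.Dart} (hd : 6 ≤ D d.snd) : big D d = 1 := if_pos hd

/-- If the excess of every small neighbour is covered by the share of its big neighbours in the
rotation, then the total charge sent is bounded. -/
theorem sum_le_of_local {v : V} {b : ℚ} (hb : 0 ≤ b)
    (hloc : ∀ d ∈ dartsAt G v, D d.snd ≤ 5 →
      give D ρ d - sides ρ d / 4 ≤ b + b / 2 * (big D (ρ.rot d) + big D (ρ.rot⁻¹ d))) :
    ∑ d ∈ dartsAt G v, (give D ρ d - sides ρ d / 4) ≤ b * G.degree v := by
  have h1 : ∀ d ∈ dartsAt G v, give D ρ d - sides ρ d / 4 ≤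
      b + b / 2 * (big D (ρ.rot d) + big D (ρ.rot⁻¹ d)) - b * big D d := by
    intro d hd
    by_cases h6 : 6 ≤ D d.snd
    · rw [give_eq_zero_of_six_le ρ h6, big_eq_one h6]
      have h2 := big_nonneg (D := D) (ρ.rot d)
      have h3 := big_nonneg (D := D) (ρ.rot⁻¹ d)
      have h4 := sides_nonneg ρ d
      have h5 : 0 ≤ b / 2 * (big D (ρ.rot d) + big D (ρ.rot⁻¹ d)) := by positivity
      linarith
    · have : big D d = 0 := if_neg h6
      rw [this]
      have := hloc d hd (by omega)
      linarith
  refine (Finset.sum_le_sum h1).trans_eq ?_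
  rw [Finset.sum_sub_distrib, Finset.sum_add_distrib, ← Finset.mul_sum, ← Finset.mul_sum,
    Finset.sum_add_distrib, ρ.sum_rot v (big D), ρ.sum_rot_inv v (big D), Finset.sum_const,
    card_dartsAt, nsmul_eq_mul]
  ring

section

include h

theorem three_le_D (v : V) : 3 ≤ D v := by
  rcases h.degree_eq v with h1 | h1
  · rw [← h1]; exact h.three_le v
  · omega

theorem degree_eq_of_le {v : V} (hv : D v ≤ 8) : G.degree v = D v := by
  rcases h.degree_eq v with h1 | h1
  · exact h1
  · omega

theorem give_eq_zero_of_le_six {d : G.Dart} (hd : D d.fst ≤ 6) : give D ρ d = 0 := by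
  have h1 : D d.snd ≠ 3 := by
    intro h3
    have := h.three_adj _ _ h3 d.adj.symm
    omega
  unfold give
  rw [if_neg h1]
  split_ifs <;> first | rfl | omega

/-- The situation around a dart: on each side, either the face is not a triangle or the next
neighbour is adjacent. -/
theorem dart_sides {v : V} {d : G.Dart} (hd : d ∈ dartsAt G v) :
    (ρ.rot d).snd ≠ v ∧ (ρ.rot⁻¹ d).snd ≠ v ∧ (ρ.rot d).snd ≠ (ρ.rot⁻¹ d).snd := by
  refine ⟨(adj_of_mem (ρ.rot_mem hd)).ne', (adj_of_mem (ρ.rot_inv_mem hd)).ne', fun he => ?_⟩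
  exact ρ.rot_ne_rot_inv d (h.three_le _) (dart_ext_of_mem (ρ.rot_mem hd) (ρ.rot_inv_mem hd) he)

/-- For a 3-vertex, every triangle at the edge contributes a big neighbour. -/
theorem cost_three {d : G.Dart} (h3 : D d.snd = 3) :
    ∃ p q : ℚ, (p = 0 ∨ p = 1) ∧ (q = 0 ∨ q = 1) ∧
      give D ρ d - sides ρ d / 4 = 1 - (p + q) / 2 ∧
      1 - p ≤ big D (ρ.rot d) ∧ 1 - q ≤ big D (ρ.rot⁻¹ d) ∧
      (p = 0 → G.Adj d.snd (ρ.rot d).snd) ∧ (q = 0 → G.Adj d.snd (ρ.rot⁻¹ d).snd) := by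
  refine ⟨ρ.nontri d, ρ.nontri d.symm, ?_, ?_, ?_, ?_, ?_, ?_, ?_⟩
  · rcases ρ.nontri_eq d with h1 | h1 <;> simp [h1]
  · rcases ρ.nontri_symm_eq d with h1 | h1 <;> simp [h1]
  · rw [give_three ρ h3]
    unfold sides
    ring
  · rcases ρ.nontri_eq d with h1 | h1
    · rw [h1]; simpa using big_nonneg _
    · rw [h1.1, big_eq_one (by have := h.three_adj _ _ h3 h1.2; omega)]; norm_num
  · rcases ρ.nontri_symm_eq d with h1 | h1
    · rw [h1]; simpa using big_nonneg _
    · rw [h1.1, big_eq_one (by have := h.three_adj _ _ h3 h1.2; omega)]; norm_num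
  · intro h0
    rcases ρ.nontri_eq d with h1 | h1
    · rw [h1] at h0; norm_num at h0
    · exact h1.2
  · intro h0
    rcases ρ.nontri_symm_eq d with h1 | h1
    · rw [h1] at h0; norm_num at h0
    · exact h1.2

omit h in
/-- A vertex all of whose neighbours are big gets at most `1 / 2`. -/
theorem cost_of_big_nbrs {d : G.Dart} {a : ℚ} (ha : give D ρ d ≤ a)
    (hbig : ∀ w, G.Adj d.snd w → w ≠ d.fst → 6 ≤ D w) :
    ∃ p q : ℚ, (p = 0 ∨ p = 1) ∧ (q = 0 ∨ q = 1) ∧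
      give D ρ d - sides ρ d / 4 ≤ a - (p + q) / 4 ∧
      1 - p ≤ big D (ρ.rot d) ∧ 1 - q ≤ big D (ρ.rot⁻¹ d) := by
  have n1 : (ρ.rot d).snd ≠ d.fst := ρ.rot_fst d ▸ (ρ.rot d).adj.ne'
  have n2 : (ρ.rot⁻¹ d).snd ≠ d.fst := ρ.rot_inv_fst d ▸ (ρ.rot⁻¹ d).adj.ne'
  refine ⟨ρ.nontri d, ρ.nontri d.symm, ?_, ?_, ?_, ?_, ?_⟩
  · rcases ρ.nontri_eq d with h1 | h1 <;> simp [h1]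
  · rcases ρ.nontri_symm_eq d with h1 | h1 <;> simp [h1]
  · unfold sides
    linarith
  · rcases ρ.nontri_eq d with h1 | h1
    · rw [h1]; simpa using big_nonneg _
    · rw [h1.1, big_eq_one (hbig _ h1.2 n1)]; norm_num
  · rcases ρ.nontri_symm_eq d with h1 | h1
    · rw [h1]; simpa using big_nonneg _
    · rw [h1.1, big_eq_one (hbig _ h1.2 n2)]; norm_num

/-- A vertex with at most one small neighbour apart from `d.fst`. -/
theorem cost_of_one_small {v : V} {d : G.Dart} (hd : d ∈ dartsAt G v) {a : ℚ}
    (ha : give D ρ d ≤ a)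
    (hbig : ∀ w x, G.Adj d.snd w → G.Adj d.snd x → w ≠ x → w ≠ v → x ≠ v → 6 ≤ D w ∨ 6 ≤ D x) :
    give D ρ d - sides ρ d / 4 ≤ a - 1 / 4 ∨
      give D ρ d - sides ρ d / 4 ≤ a ∧ 1 ≤ big D (ρ.rot d) + big D (ρ.rot⁻¹ d) := by
  obtain ⟨n1, n2, n3⟩ := h.dart_sides ρ hd
  have e1 := ρ.nontri_nonneg d
  have e2 := ρ.nontri_nonneg d.symm
  unfold sides
  rcases ρ.nontri_eq d with h1 | h1
  · left; linarith
  rcases ρ.nontri_symm_eq d with h2 | h2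
  · left; linarith
  right
  refine ⟨by linarith, ?_⟩
  have b1 := big_nonneg (D := D) (ρ.rot d)
  have b2 := big_nonneg (D := D) (ρ.rot⁻¹ d)
  rcases hbig _ _ h1.2 h2.2 n3 n1 n2 with h6 | h6
  · rw [big_eq_one h6]; linarith
  · rw [big_eq_one h6]; linarith

omit h in
/-- The charge sent is at most the number of small neighbours. -/
theorem sum_le_card (v : V) : ∑ d ∈ dartsAt G v, (give D ρ d - sides ρ d / 4) ≤
    ((G.neighborFinset v).filter fun w => D w ≤ 5).card := by
  rw [← card_filter_dartsAt, Finset.card_filter, Nat.cast_sum]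
  refine Finset.sum_le_sum fun d _ => ?_
  have h1 := sides_nonneg ρ d
  by_cases h5 : D d.snd ≤ 5
  · have := give_le_one (D := D) ρ d
    simp only [h5, if_true]
    push_cast
    linarith
  · rw [give_eq_zero_of_six_le ρ (by omega)]
    simp only [h5, if_false]
    push_cast
    linarith

/-- Two further neighbours of degree at most 5 would give a sum of at most 5 + 5 + 8 = 18. -/
theorem five_small {v : V} {d : G.Dart} (hd : d ∈ dartsAt G v) (h5 : D d.snd = 5)
    (hv : D v ≤ 8) : ∀ w x, G.Adj d.snd w → G.Adj d.snd x → w ≠ x → w ≠ v → x ≠ v →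
      6 ≤ D w ∨ 6 ≤ D x := by
  intro w x hw hx hwx hwv hxv
  have := h.five d.snd w x v h5 hw hx (adj_of_mem hd).symm hwx hwv hxv
  omega

omit h in
/-- Bounds for the charge sent to a 5-vertex. -/
theorem cost_five {v : V} {d : G.Dart} (hd : d ∈ dartsAt G v) (hv : 8 ≤ D v)
    (h5 : D d.snd = 5) :
    give D ρ d - sides ρ d / 4 ≤ 1 / 3 ∨ ∃ p q : ℚ, (p = 0 ∨ p = 1) ∧ (q = 0 ∨ q = 1) ∧
      give D ρ d - sides ρ d / 4 ≤ 1 / 2 - (p + q) / 4 ∧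
      1 - p ≤ big D (ρ.rot d) ∧ 1 - q ≤ big D (ρ.rot⁻¹ d) := by
  have hf : d.fst = v := mem_dartsAt.1 hd
  by_cases hs : ∀ w, G.Adj d.snd w → 6 ≤ D w
  · right
    refine cost_of_big_nbrs ρ ?_ fun w hw _ => hs w hw
    rw [give_five ρ h5 (by rw [hf]; exact hv), if_pos hs]
  · left
    have := sides_nonneg ρ d
    rw [give_five ρ h5 (by rw [hf]; exact hv), if_neg hs]
    linarith

/-- Bounds for the charge sent to a 4-vertex by a vertex of degree 8, 9 or 10. -/
theorem cost_four {v : V} {d : G.Dart} (hd : d ∈ dartsAt G v) (hv : 8 ≤ D v) (hv' : D v ≤ 10)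
    (h4 : D d.snd = 4) : ∃ p q : ℚ, (p = 0 ∨ p = 1) ∧ (q = 0 ∨ q = 1) ∧
      give D ρ d - sides ρ d / 4 ≤ 1 / 2 - (p + q) / 4 ∧
      1 - p ≤ big D (ρ.rot d) ∧ 1 - q ≤ big D (ρ.rot⁻¹ d) := by
  have hf : d.fst = v := mem_dartsAt.1 hd
  have hs : ∀ w, G.Adj d.snd w → 8 ≤ D w := by
    intro w hw
    by_contra hc
    have hwv : w ≠ v := by rintro rfl; omega
    have := h.four d.snd w v h4 hw (adj_of_mem hd).symm hwv (by omega)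
    omega
  refine cost_of_big_nbrs ρ ?_ fun w hw _ => by have := hs w hw; omega
  rw [give_four ρ h4 (by rw [hf]; exact hv), if_neg]
  rintro ⟨w, hw, hw7⟩
  have := hs w hw
  omega

theorem small_cases {d : G.Dart} (hd : D d.snd ≤ 5) :
    D d.snd = 3 ∨ D d.snd = 4 ∨ D d.snd = 5 := by
  have := h.three_le_D d.snd
  omega

theorem sum_eight {v : V} (hv : D v = 8) :
    ∑ d ∈ dartsAt G v, (give D ρ d - sides ρ d / 4) ≤ 2 := by
  have hdeg := h.degree_eq_of_le hv.le
  -- The share `b` is the available charge per neighbour, (8 − 6) / 8; likewise 3 / 9 and 4 / 10 for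
  -- degrees 9 and 10.
  refine (sum_le_of_local ρ (b := 1 / 4) (by norm_num) fun d hd hs => ?_).trans_eq ?_
  · rcases h.small_cases hs with h3 | h4 | h5
    · have := h.three_adj _ _ h3 (adj_of_mem hd).symm
      omega
    · obtain ⟨p, q, hp, hq, h1, h2, h3⟩ := h.cost_four ρ hd hv.ge (by omega) h4
      rcases hp with rfl | rfl <;> rcases hq with rfl | rfl <;> linarith
    · rcases cost_five ρ hd hv.ge h5 with h1 | ⟨p, q, hp, hq, h1, h2, h3⟩
      · have b1 := big_nonneg (D := D) (ρ.rot d)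
        have b2 := big_nonneg (D := D) (ρ.rot⁻¹ d)
        have hg : give D ρ d ≤ 1 / 2 := by
          rw [give_five ρ h5 (by rw [mem_dartsAt.1 hd, hv])]
          split_ifs <;> norm_num
        rcases h.cost_of_one_small ρ hd hg (h.five_small hd h5 hv.le) with h2 | h2
        · linarith
        · linarith [h2.2]
      · rcases hp with rfl | rfl <;> rcases hq with rfl | rfl <;> linarith
  · rw [hdeg, hv]; norm_num

/-- No edge from a 9-vertex to a 3-vertex lies on a triangle, so 3-neighbours cost nothing net. Only
4- and 5-neighbours need the averaging. -/
theorem sum_nine {v : V} (hdeg : G.degree v = D v) (hv : D v = 9) :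
    ∑ d ∈ dartsAt G v, (give D ρ d - sides ρ d / 4) ≤ 3 := by
  refine (sum_le_of_local ρ (b := 1 / 3) (by norm_num) fun d hd hs => ?_).trans_eq ?_
  · have b1 := big_nonneg (D := D) (ρ.rot d)
    have b2 := big_nonneg (D := D) (ρ.rot⁻¹ d)
    have hadj := (adj_of_mem hd).symm
    rcases h.small_cases hs with h3 | h4 | h5
    · obtain ⟨p, q, hp, hq, h1, -, -, hp', hq'⟩ := h.cost_three ρ h3
      rcases hp with rfl | rfl
      · exact absurd (adj_of_mem (ρ.rot_mem hd)) (h.three_nine _ _ _ h3 hv hadj (hp' rfl))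
      rcases hq with rfl | rfl
      · exact absurd (adj_of_mem (ρ.rot_inv_mem hd)) (h.three_nine _ _ _ h3 hv hadj (hq' rfl))
      linarith
    · obtain ⟨p, q, hp, hq, h1, h2, h3⟩ := h.cost_four ρ hd (by omega) (by omega) h4
      rcases hp with rfl | rfl <;> rcases hq with rfl | rfl <;> linarith
    · rcases cost_five ρ hd (by omega) h5 with h1 | ⟨p, q, hp, hq, h1, h2, h3⟩
      · linarith
      · rcases hp with rfl | rfl <;> rcases hq with rfl | rfl <;> linarith
  · rw [hdeg, hv]; norm_num

/-- With at most four small neighbours each costs at most 1. Otherwise `three_ten` forbids a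
3-neighbour between two triangular faces, whose cost 1 would exceed 2b = 4/5; with one triangle the
cost is 1/2 and one big rotation neighbour suffices. -/
theorem sum_ten {v : V} (hdeg : G.degree v = D v) (hv : D v = 10) :
    ∑ d ∈ dartsAt G v, (give D ρ d - sides ρ d / 4) ≤ 4 := by
  by_cases hten : ((G.neighborFinset v).filter fun w => D w ≤ 5).card ≤ 4
  · refine (sum_le_card ρ v).trans ?_
    exact_mod_cast hten
  refine (sum_le_of_local ρ (b := 2 / 5) (by norm_num) fun d hd hs => ?_).trans_eq ?_
  · have b1 := big_nonneg (D := D) (ρ.rot d)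
    have b2 := big_nonneg (D := D) (ρ.rot⁻¹ d)
    have hadj := (adj_of_mem hd).symm
    rcases h.small_cases hs with h3 | h4 | h5
    · obtain ⟨p, q, hp, hq, h1, h2, h2', hp', hq'⟩ := h.cost_three ρ h3
      rcases hp with rfl | rfl <;> rcases hq with rfl | rfl
      · exact absurd (h.three_ten _ _ _ _ h3 hv hadj (h.dart_sides ρ hd).2.2 (hp' rfl)
          (adj_of_mem (ρ.rot_mem hd)) (hq' rfl) (adj_of_mem (ρ.rot_inv_mem hd))) hten
      all_goals linarith
    · obtain ⟨p, q, hp, hq, h1, h2, h3⟩ := h.cost_four ρ hd (by omega) (by omega) h4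
      rcases hp with rfl | rfl <;> rcases hq with rfl | rfl <;> linarith
    · rcases cost_five ρ hd (by omega) h5 with h1 | ⟨p, q, hp, hq, h1, h2, h3⟩
      · linarith
      · rcases hp with rfl | rfl <;> rcases hq with rfl | rfl <;> linarith
  · rw [hdeg, hv]; norm_num

/-- The share 1/2 lets two big rotation neighbours cover even the maximal cost 1, and deg / 2 ≤ deg
− 6 from degree 12 on. -/
theorem sum_twelve {v : V} (hdeg : G.degree v = D v) (hv : 12 ≤ D v) :
    ∑ d ∈ dartsAt G v, (give D ρ d - sides ρ d / 4) ≤ (D v : ℚ) - 6 := by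
  refine (sum_le_of_local ρ (b := 1 / 2) (by norm_num) fun d hd hs => ?_).trans ?_
  · have b1 := big_nonneg (D := D) (ρ.rot d)
    have b2 := big_nonneg (D := D) (ρ.rot⁻¹ d)
    have hadj := (adj_of_mem hd).symm
    rcases h.small_cases hs with h3 | h4 | h5
    · obtain ⟨p, q, hp, hq, h1, h2, h2', -⟩ := h.cost_three ρ h3
      rcases hp with rfl | rfl <;> rcases hq with rfl | rfl <;> linarith
    · have hg : give D ρ d ≤ 2 / 3 := by
        rw [give_four ρ h4 (by rw [mem_dartsAt.1 hd]; omega)]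
        split_ifs <;> norm_num
      rcases h.cost_of_one_small ρ hd hg (fun w x hw hx hwx _ _ => by
        by_contra hc
        have := h.four d.snd w x h4 hw hx hwx (by omega)
        omega) with h1 | h1
      · linarith
      · linarith [h1.2]
    · rcases cost_five ρ hd (by omega) h5 with h1 | ⟨p, q, hp, hq, h1, h2, h3⟩
      · linarith
      · rcases hp with rfl | rfl <;> rcases hq with rfl | rfl <;> linarith
  · rw [hdeg]
    have : (12 : ℚ) ≤ D v := by exact_mod_cast hv
    linarith

end

end ConfigFree

end SimpleGraph

/-! ### Degrees 7 and 11, the receiving vertices, and the final charge. -/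

namespace SimpleGraph

open RotationSystem

set_option linter.unusedSectionVars false

namespace ConfigFree

variable {V : Type*} [Fintype V] [DecidableEq V] {G : SimpleGraph V} [DecidableRel G.Adj]
  {D : V → ℕ} (h : ConfigFree G D) (ρ : G.RotationSystem)

include h

/-- Three consecutive 5-neighbours with triangles between them would give the middle one neighbours
of degrees 5, 5, 7, against `five`. So each window of three darts holds at most two 5-neighbours, up
to a correction for non-triangular faces, and summing over the windows bounds their number. -/
theorem sum_seven {v : V} (hv : D v = 7) :
    ∑ d ∈ dartsAt G v, (give D ρ d - sides ρ d / 4) ≤ 1 := by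
  have hdeg : G.degree v = 7 := (h.degree_eq_of_le (by omega)).trans hv
  let f : G.Dart → ℚ := fun d => if D d.snd = 5 then 1 else 0
  have hf : ∀ d, 0 ≤ f d ∧ f d ≤ 1 := by
    intro d
    simp only [f]
    split_ifs <;> norm_num
  have hgive : ∀ d ∈ dartsAt G v, give D ρ d = f d / 4 := by
    intro d hd
    have hfst := mem_dartsAt.1 hd
    by_cases h5 : D d.snd = 5
    · rw [give_five_seven ρ h5 (by rw [hfst, hv])]
      simp [f, h5]
    · have h3 : D d.snd ≠ 3 := by
        intro h3
        have := h.three_adj _ _ h3 (adj_of_mem hd).symm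
        omega
      unfold give
      rw [if_neg h3, if_neg h5, hfst, hv]
      simp [f, h5]
  have hwin : ∀ d ∈ dartsAt G v, f d + f (ρ.rot d) + f (ρ.rot (ρ.rot d)) ≤
      2 + (ρ.nontri d + ρ.nontri (ρ.rot d)) := by
    intro d hd
    have hd1 := ρ.rot_mem hd
    have hd2 := ρ.rot_mem hd1
    have n1 := ρ.nontri_nonneg d
    have n2 := ρ.nontri_nonneg (ρ.rot d)
    have f0 := hf d
    have f1 := hf (ρ.rot d)
    have f2 := hf (ρ.rot (ρ.rot d))
    rcases ρ.nontri_eq d with e1 | e1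
    · linarith [f0.2, f1.2, f2.2]
    rcases ρ.nontri_eq (ρ.rot d) with e2 | e2
    · linarith [f0.2, f1.2, f2.2]
    by_cases g0 : D d.snd = 5
    · by_cases g1 : D (ρ.rot d).snd = 5
      · by_cases g2 : D (ρ.rot (ρ.rot d)).snd = 5
        · exfalso
          have hne := (h.dart_sides ρ hd1).2.2
          rw [rot_inv_rot] at hne
          have := h.five (ρ.rot d).snd d.snd (ρ.rot (ρ.rot d)).snd v g1 e1.2.symm e2.2
            (adj_of_mem hd1).symm hne.symm (adj_of_mem hd).ne' (adj_of_mem hd2).ne'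
          omega
        · have : f (ρ.rot (ρ.rot d)) = 0 := if_neg g2
          linarith [f0.2, f1.2]
      · have : f (ρ.rot d) = 0 := if_neg g1
        linarith [f0.2, f2.2]
    · have : f d = 0 := if_neg g0
      linarith [f1.2, f2.2]
  have hsum := Finset.sum_le_sum hwin
  rw [Finset.sum_add_distrib, Finset.sum_add_distrib, Finset.sum_add_distrib,
    Finset.sum_add_distrib, ρ.sum_rot v fun d => f (ρ.rot d), ρ.sum_rot v f,
    ρ.sum_rot v ρ.nontri, Finset.sum_const, card_dartsAt, hdeg] at hsum
  rw [Finset.sum_sub_distrib, ← Finset.sum_div, sum_sides, Finset.sum_congr rfl hgive,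
    ← Finset.sum_div]
  obtain ⟨a, ha⟩ : ∃ a : ℕ, ∑ d ∈ dartsAt G v, f d = a := by
    refine ⟨((dartsAt G v).filter fun d => D d.snd = 5).card, ?_⟩
    simp only [f, Finset.sum_boole]
  obtain ⟨s, hs⟩ : ∃ s : ℕ, ∑ d ∈ dartsAt G v, ρ.nontri d = s := by
    classical
    refine ⟨((dartsAt G v).filter fun d => ¬ (ρ.face ^ 3) d = d).card, ?_⟩
    rw [Finset.card_filter, Nat.cast_sum]
    refine Finset.sum_congr rfl fun d _ => ?_
    unfold nontri
    split_ifs <;> simp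
  rw [ha, hs] at hsum ⊢
  -- Integrality matters: for `s = 0` the rational bound 14/3 exceeds the admissible 4.
  have h1 : 3 * a ≤ 14 + 2 * s := by
    have : (3 * a : ℚ) ≤ 14 + 2 * s := by
      norm_num at hsum
      linarith
    exact_mod_cast this
  have h2 : a ≤ 4 + 2 * s := by omega
  have h3 : (a : ℚ) ≤ 4 + 2 * s := by exact_mod_cast h2
  linarith

/-- The share 1/2 would allow 11/2, which is 1/2 too much. A dart of cost above 1/2 (set `A`) has
big rotation neighbours (set `Z`) on both sides, so |A| ≤ |Z|. A strict inequality saves the missing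
1/2. In case of equality, either both sets are empty and every cost is at most 1/3, or `A` and `Z`
alternate around the vertex, which is impossible for the odd degree 11. -/
theorem sum_eleven {v : V} (hdeg : G.degree v = D v) (hv : D v = 11) :
    ∑ d ∈ dartsAt G v, (give D ρ d - sides ρ d / 4) ≤ 5 := by
  have hcard : (dartsAt G v).card = 11 := by rw [card_dartsAt, hdeg, hv]
  set cost : G.Dart → ℚ := fun d => give D ρ d - sides ρ d / 4 with hcost
  have hle1 : ∀ d, cost d ≤ 1 := by
    intro d
    have h1 := give_le_one (D := D) ρ d
    have h2 := sides_nonneg ρ d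
    simp only [hcost]
    linarith
  have hzero : ∀ d, 6 ≤ D d.snd → cost d ≤ 0 := by
    intro d hd
    have h2 := sides_nonneg ρ d
    simp only [hcost, give_eq_zero_of_six_le ρ hd]
    linarith
  have hsmall : ∀ d ∈ dartsAt G v, D d.snd ≤ 5 → cost d ≤ 1 / 3 ∨
      ∃ p q : ℚ, (p = 0 ∨ p = 1) ∧ (q = 0 ∨ q = 1) ∧
        (cost d ≤ 2 / 3 - (p + q) / 4 ∨ cost d ≤ 1 - (p + q) / 2) ∧
        1 - p ≤ big D (ρ.rot d) ∧ 1 - q ≤ big D (ρ.rot⁻¹ d) := by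
    intro d hd hs
    rcases h.small_cases hs with h3 | h4 | h5
    · obtain ⟨p, q, hp, hq, h1, h2, h2', -⟩ := h.cost_three ρ h3
      exact Or.inr ⟨p, q, hp, hq, Or.inr h1.le, h2, h2'⟩
    · have hg : give D ρ d ≤ 2 / 3 := by
        rw [give_four ρ h4 (by rw [mem_dartsAt.1 hd]; omega)]
        split_ifs <;> norm_num
      obtain ⟨p, q, hp, hq, h1, h2, h2'⟩ := cost_of_big_nbrs ρ hg (by
        intro w hw hwv
        rw [mem_dartsAt.1 hd] at hwv
        by_contra hc
        have := h.four d.snd w v h4 hw (adj_of_mem hd).symm hwv (by omega)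
        omega)
      exact Or.inr ⟨p, q, hp, hq, Or.inl h1, h2, h2'⟩
    · rcases cost_five ρ hd (by omega) h5 with h1 | ⟨p, q, hp, hq, h1, h2, h2'⟩
      · exact Or.inl h1
      · exact Or.inr ⟨p, q, hp, hq, Or.inl (h1.trans (by linarith)), h2, h2'⟩
  have hbig : ∀ d : G.Dart, 0 < big D d → 6 ≤ D d.snd := by
    intro d hd
    by_contra hc
    unfold big at hd
    rw [if_neg hc] at hd
    exact lt_irrefl _ hd
  let Z := (dartsAt G v).filter fun d => 6 ≤ D d.snd
  let A := (dartsAt G v).filter fun d => 1 / 2 < cost d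
  have hAZ : Disjoint A Z := by
    rw [Finset.disjoint_left]
    intro d hA hZ
    have h1 := (Finset.mem_filter.1 hA).2
    have h2 := hzero d (Finset.mem_filter.1 hZ).2
    linarith
  have hAsides : ∀ d ∈ A, ρ.rot d ∈ Z ∧ ρ.rot⁻¹ d ∈ Z := by
    intro d hA
    obtain ⟨hd, hc⟩ := Finset.mem_filter.1 hA
    have hs : D d.snd ≤ 5 := by
      by_contra h6
      have := hzero d (by omega)
      linarith
    rcases hsmall d hd hs with h1 | ⟨p, q, hp, hq, h1, h2, h3⟩
    · linarith
    · have hpq : p = 0 ∧ q = 0 := by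
        rcases hp with rfl | rfl <;> rcases hq with rfl | rfl
        · exact ⟨rfl, rfl⟩
        all_goals rcases h1 with h1 | h1 <;> linarith
      obtain ⟨rfl, rfl⟩ := hpq
      exact ⟨Finset.mem_filter.2 ⟨ρ.rot_mem hd, hbig _ (by linarith)⟩,
        Finset.mem_filter.2 ⟨ρ.rot_inv_mem hd, hbig _ (by linarith)⟩⟩
  have himg : A.image ρ.rot ⊆ Z := by
    intro e he
    obtain ⟨d, hd, rfl⟩ := Finset.mem_image.1 he
    exact (hAsides d hd).1
  have himg' : A.image (⇑(ρ.rot⁻¹)) ⊆ Z := by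
    intro e he
    obtain ⟨d, hd, rfl⟩ := Finset.mem_image.1 he
    exact (hAsides d hd).2
  have hcardimg : (A.image ρ.rot).card = A.card :=
    Finset.card_image_of_injective _ ρ.rot.injective
  have hcardimg' : (A.image (⇑(ρ.rot⁻¹))).card = A.card :=
    Finset.card_image_of_injective _ (ρ.rot⁻¹).injective
  have hle : A.card ≤ Z.card := hcardimg ▸ Finset.card_le_card himg
  rcases hle.lt_or_eq with hlt | heq
  · have hbound : ∀ d ∈ dartsAt G v, cost d ≤
        1 / 2 + (if 1 / 2 < cost d then 1 / 2 else 0) - (if 6 ≤ D d.snd then 1 / 2 else 0) := by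
      intro d hd
      have h1 := hle1 d
      by_cases h6 : 6 ≤ D d.snd
      · have := hzero d h6
        rw [if_pos h6, if_neg (by linarith)]
        linarith
      · rw [if_neg h6]
        by_cases hc : 1 / 2 < cost d
        · rw [if_pos hc]; linarith
        · rw [if_neg hc]; linarith
    refine (Finset.sum_le_sum hbound).trans ?_
    rw [Finset.sum_sub_distrib, Finset.sum_add_distrib, Finset.sum_const, hcard,
      ← Finset.sum_filter, ← Finset.sum_filter, Finset.sum_const, Finset.sum_const]
    change 11 • (1 / 2 : ℚ) + A.card • (1 / 2 : ℚ) - Z.card • (1 / 2 : ℚ) ≤ 5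
    have : (A.card : ℚ) + 1 ≤ Z.card := by exact_mod_cast hlt
    simp only [nsmul_eq_mul]
    push_cast
    linarith
  · have hZ : A.image (⇑(ρ.rot⁻¹)) = Z :=
      Finset.eq_of_subset_of_card_le himg' (by rw [hcardimg', heq])
    rcases Z.eq_empty_or_nonempty with hZe | ⟨z, hz⟩
    · have hnoZ : ∀ d ∈ dartsAt G v, ¬ 6 ≤ D d.snd := by
        intro d hd h6
        have : d ∈ Z := Finset.mem_filter.2 ⟨hd, h6⟩
        rw [hZe] at this
        exact absurd this (Finset.notMem_empty _)
      have hthird : ∀ d ∈ dartsAt G v, cost d ≤ 1 / 3 := by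
        intro d hd
        have h6 := hnoZ d hd
        rcases hsmall d hd (by omega) with h1 | ⟨p, q, hp, hq, h1, h2, h3⟩
        · exact h1
        · have b1 : big D (ρ.rot d) = 0 := if_neg (hnoZ _ (ρ.rot_mem hd))
          have b2 : big D (ρ.rot⁻¹ d) = 0 := if_neg (hnoZ _ (ρ.rot_inv_mem hd))
          rw [b1] at h2
          rw [b2] at h3
          rcases h1 with h1 | h1 <;> linarith
      refine (Finset.sum_le_card_nsmul _ _ _ hthird).trans ?_
      rw [hcard]
      norm_num
    · exfalso
      obtain ⟨hzv, -⟩ := Finset.mem_filter.1 hz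
      have hall : ∀ d ∈ dartsAt G v, d ∈ A ∪ Z := by
        intro d hd
        refine ρ.of_closed (p := fun d => d ∈ A ∪ Z) (d := z) (Finset.mem_union_right _ hz) ?_
          ((mem_dartsAt.1 hd).trans (mem_dartsAt.1 hzv).symm)
        intro e _ he
        rcases Finset.mem_union.1 he with he | he
        · exact Finset.mem_union_right _ (hAsides e he).1
        · rw [← hZ] at he
          obtain ⟨a, ha, rfl⟩ := Finset.mem_image.1 he
          rw [rot_rot_inv]
          exact Finset.mem_union_left _ ha
      have heq' : dartsAt G v = A ∪ Z := by
        refine Finset.Subset.antisymm hall ?_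
        exact Finset.union_subset (Finset.filter_subset _ _) (Finset.filter_subset _ _)
      have := Finset.card_union_of_disjoint hAZ
      rw [← heq', hcard] at this
      omega

/-- If some neighbour has degree at most 7, the other three have degree at least 11 by `four` and
send 2/3 each; otherwise all four send 1/2. -/
theorem receive_four {v : V} (hv : D v = 4) : 2 ≤ ∑ d ∈ dartsAt G v, give D ρ d.symm := by
  have hcard : (dartsAt G v).card = 4 := by
    rw [card_dartsAt, h.degree_eq_of_le (by omega), hv]
  by_cases hbad : ∃ w, G.Adj v w ∧ D w ≤ 7
  · obtain ⟨w, hw, hw7⟩ := hbad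
    let e : G.Dart := ⟨(v, w), hw⟩
    have he : e ∈ dartsAt G v := mem_dartsAt.2 rfl
    have hge : ∀ d ∈ (dartsAt G v).erase e, 2 / 3 ≤ give D ρ d.symm := by
      intro d hd
      obtain ⟨hne, hd⟩ := Finset.mem_erase.1 hd
      have hwd : w ≠ d.snd := fun h' => hne (dart_ext_of_mem hd he h'.symm)
      have h18 := h.four v w d.snd hv hw (adj_of_mem hd) hwd hw7
      have hs : d.symm.snd = v := mem_dartsAt.1 hd
      have hfst : D d.symm.fst = D d.snd := rfl
      rw [give_four ρ (by rw [hs, hv]) (by omega), if_pos ⟨w, by rw [hs]; exact hw, hw7⟩]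
    have h1 := Finset.card_nsmul_le_sum _ _ _ hge
    rw [Finset.card_erase_of_mem he, hcard] at h1
    have h2 := Finset.sum_le_sum_of_subset_of_nonneg (Finset.erase_subset e (dartsAt G v))
      fun d _ _ => give_nonneg (D := D) ρ d.symm
    refine le_trans ?_ (h1.trans h2)
    norm_num
  · have hge : ∀ d ∈ dartsAt G v, 1 / 2 ≤ give D ρ d.symm := by
      intro d hd
      have h8 : ¬ D d.snd ≤ 7 := fun h7 => hbad ⟨d.snd, adj_of_mem hd, h7⟩
      have hs : d.symm.snd = v := mem_dartsAt.1 hd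
      have hfst : D d.symm.fst = D d.snd := rfl
      rw [give_four ρ (by rw [hs, hv]) (by omega)]
      split_ifs <;> norm_num
    have h1 := Finset.card_nsmul_le_sum _ _ _ hge
    rw [hcard] at h1
    refine le_trans ?_ h1
    norm_num

/-- By `five` at most two neighbours have degree at most 6 (set `S`). If `S` has at most one
element, four neighbours send at least 1/4 each. The remaining cases have |S| = 2. -/
theorem receive_five {v : V} (hv : D v = 5) :
    1 ≤ ∑ d ∈ dartsAt G v, (sides ρ d / 4 + give D ρ d.symm) := by
  have hcard : (dartsAt G v).card = 5 := by
    rw [card_dartsAt, h.degree_eq_of_le (by omega), hv]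
  let S := (dartsAt G v).filter fun d => D d.snd ≤ 6
  let T := (dartsAt G v).filter fun d => D d.snd = 7
  let U := (dartsAt G v).filter fun d => 8 ≤ D d.snd
  have hSTU : S.card + T.card + U.card = 5 := by
    rw [← hcard, Finset.card_filter, Finset.card_filter, Finset.card_filter,
      ← Finset.sum_add_distrib, ← Finset.sum_add_distrib, Finset.card_eq_sum_ones]
    refine Finset.sum_congr rfl fun d _ => ?_
    split_ifs <;> first | rfl | omega
  have hS : S.card ≤ 2 := by
    by_contra hc
    obtain ⟨a, ha, b, hb, c, hc, hab, hac, hbc⟩ := Finset.two_lt_card.1 (not_le.1 hc)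
    obtain ⟨ha, ha6⟩ := Finset.mem_filter.1 ha
    obtain ⟨hb, hb6⟩ := Finset.mem_filter.1 hb
    obtain ⟨hc, hc6⟩ := Finset.mem_filter.1 hc
    have := h.five v a.snd b.snd c.snd hv (adj_of_mem ha) (adj_of_mem hb) (adj_of_mem hc)
      (fun e => hab (dart_ext_of_mem ha hb e)) (fun e => hac (dart_ext_of_mem ha hc e))
      (fun e => hbc (dart_ext_of_mem hb hc e))
    omega
  have hsum : ∀ x : ℚ, (∀ d ∈ U, x ≤ give D ρ d.symm) →
      T.card * (1 / 4) + U.card * x ≤ ∑ d ∈ dartsAt G v, give D ρ d.symm := by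
    intro x hx
    have h1 : ∀ d ∈ dartsAt G v, (if D d.snd = 7 then 1 / 4 else 0) +
        (if 8 ≤ D d.snd then x else 0) ≤ give D ρ d.symm := by
      intro d hd
      have hs : d.symm.snd = v := mem_dartsAt.1 hd
      have hfst : D d.symm.fst = D d.snd := rfl
      by_cases h7 : D d.snd = 7
      · rw [if_pos h7, if_neg (by omega), give_five_seven ρ (by rw [hs, hv]) (hfst.trans h7),
          add_zero]
      · rw [if_neg h7, zero_add]
        by_cases h8 : 8 ≤ D d.snd
        · rw [if_pos h8]
          exact hx d (Finset.mem_filter.2 ⟨hd, h8⟩)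
        · rw [if_neg h8]
          exact give_nonneg ρ _
    refine le_trans ?_ (Finset.sum_le_sum h1)
    rw [Finset.sum_add_distrib, ← Finset.sum_filter, ← Finset.sum_filter, Finset.sum_const,
      Finset.sum_const, nsmul_eq_mul, nsmul_eq_mul]
  have hsides : 0 ≤ ∑ d ∈ dartsAt G v, sides ρ d / 4 :=
    Finset.sum_nonneg fun d _ => by have := sides_nonneg ρ d; positivity
  rw [Finset.sum_add_distrib]
  have hQ : (S.card : ℚ) + T.card + U.card = 5 := by exact_mod_cast hSTU
  have hU0 : (0 : ℚ) ≤ U.card := Nat.cast_nonneg _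
  by_cases hsp : ∀ w, G.Adj v w → 6 ≤ D w
  · have hhalf := hsum (1 / 2) (by
      intro d hd
      obtain ⟨hd, h8⟩ := Finset.mem_filter.1 hd
      have hs : d.symm.snd = v := mem_dartsAt.1 hd
      rw [give_five ρ (by rw [hs, hv]) h8, if_pos (by rw [hs]; exact hsp)])
    by_cases hS1 : S.card ≤ 1
    · have : (S.card : ℚ) ≤ 1 := by exact_mod_cast hS1
      linarith
    · have hS2 : S.card = 2 := by omega
      have hS2' : (S.card : ℚ) = 2 := by exact_mod_cast hS2
      by_cases hU : U.card = 0
      · rw [Finset.card_eq_zero] at hU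
        have h67 : ∀ w, G.Adj v w → D w = 6 ∨ D w = 7 := by
          intro w hw
          have h6 := hsp w hw
          by_contra hc
          have : (⟨(v, w), hw⟩ : G.Dart) ∈ U :=
            Finset.mem_filter.2 ⟨mem_dartsAt.2 rfl, by change 8 ≤ D w; omega⟩
          rw [hU] at this
          exact absurd this (Finset.notMem_empty _)
        have h6card : ((G.neighborFinset v).filter fun w => D w = 6).card = 2 := by
          rw [← card_filter_dartsAt, ← hS2]
          congr 1
          refine Finset.filter_congr fun d hd => ?_
          have := hsp d.snd (adj_of_mem hd)
          omega
        have hno := h.five_six_seven v hv h67 h6card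
        -- The degrees are 6, 6, 7, 7, 7, and the 7-vertices send only 3/4. Where the rotation
        -- passes from a 6-neighbour to a 7-neighbour these are not adjacent, so the face there is
        -- not a triangle and supplies the missing 1/4.
        have hswitch : ∃ d ∈ dartsAt G v, 1 ≤ sides ρ d := by
          by_contra hcon
          have hnext : ∀ d ∈ dartsAt G v, D d.snd = 6 → D (ρ.rot d).snd = 6 := by
            intro d hd hd6
            rcases h67 _ (adj_of_mem (ρ.rot_mem hd)) with h6 | h7
            · exact h6
            · exfalso
              rcases ρ.nontri_eq d with h1 | h1
              · refine hcon ⟨d, hd, ?_⟩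
                have := ρ.nontri_nonneg d.symm
                unfold sides
                linarith
              · exact hno _ _ (adj_of_mem hd) (adj_of_mem (ρ.rot_mem hd)) hd6 h7 h1.2
          obtain ⟨d, hd⟩ : S.Nonempty := Finset.card_pos.1 (by omega)
          obtain ⟨hd, hd6⟩ := Finset.mem_filter.1 hd
          have hd6 : D d.snd = 6 := le_antisymm hd6 (hsp _ (adj_of_mem hd))
          have hall : ∀ e ∈ dartsAt G v, D e.snd = 6 := by
            intro e he
            refine ρ.of_closed (p := fun e => D e.snd = 6) (d := d) hd6 ?_
              ((mem_dartsAt.1 he).trans (mem_dartsAt.1 hd).symm)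
            intro e he
            exact hnext e (mem_dartsAt.2 (he.trans (mem_dartsAt.1 hd)))
          have : S = dartsAt G v :=
            Finset.filter_true_of_mem fun e he => (hall e he).le
          rw [this] at hS2
          omega
        obtain ⟨d, hd, hd1⟩ := hswitch
        have h1 := Finset.single_le_sum (f := fun d => sides ρ d / 4)
          (fun d _ => by have := sides_nonneg ρ d; positivity) hd
        linarith
      · have : (1 : ℚ) ≤ U.card := by exact_mod_cast Nat.one_le_iff_ne_zero.2 hU
        linarith
  · have hthird := hsum (1 / 3) (by
      intro d hd
      obtain ⟨hd, h8⟩ := Finset.mem_filter.1 hd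
      have hs : d.symm.snd = v := mem_dartsAt.1 hd
      rw [give_five ρ (by rw [hs, hv]) h8]
      split_ifs <;> norm_num)
    push Not at hsp
    obtain ⟨w, hw, hw5⟩ := hsp
    by_cases hS1 : S.card ≤ 1
    · have : (S.card : ℚ) ≤ 1 := by exact_mod_cast hS1
      linarith
    · have hS2 : S.card = 2 := by omega
      have hS2' : (S.card : ℚ) = 2 := by exact_mod_cast hS2
      -- A 7-neighbour, `w` and the other element of `S` would have degree sum at most 7 + 5 + 6 =
      -- 18. So three neighbours have degree at least 8 and send 1/3 each.
      have hT : T = ∅ := by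
        rw [Finset.eq_empty_iff_forall_notMem]
        intro t ht
        obtain ⟨ht, ht7⟩ := Finset.mem_filter.1 ht
        obtain ⟨a, ha, haw⟩ : ∃ a ∈ S, a ≠ (⟨(v, w), hw⟩ : G.Dart) :=
          Finset.exists_mem_ne (by omega) _
        obtain ⟨ha, ha6⟩ := Finset.mem_filter.1 ha
        have := h.five v w a.snd t.snd hv hw (adj_of_mem ha) (adj_of_mem ht)
          (fun e => haw (dart_ext_of_mem ha (mem_dartsAt.2 rfl) e.symm))
          (fun e => by rw [← e] at ht7; omega) (fun e => by rw [← e] at ht7; omega)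
        omega
      rw [hT] at hthird hQ
      simp only [Finset.card_empty, Nat.cast_zero] at hthird hQ
      linarith

/-- After discharging, no vertex has negative charge. -/
theorem charge_nonneg (v : V) : 0 ≤ (G.degree v : ℚ) - 6 +
    ∑ d ∈ dartsAt G v, (sides ρ d / 4 - give D ρ d + give D ρ d.symm) := by
  have h3D := h.three_le_D v
  have hsplit : ∑ d ∈ dartsAt G v, (sides ρ d / 4 - give D ρ d + give D ρ d.symm) =
      ∑ d ∈ dartsAt G v, give D ρ d.symm -
        ∑ d ∈ dartsAt G v, (give D ρ d - sides ρ d / 4) := by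
    rw [← Finset.sum_sub_distrib]
    exact Finset.sum_congr rfl fun d _ => by ring
  have hrec : 0 ≤ ∑ d ∈ dartsAt G v, give D ρ d.symm :=
    Finset.sum_nonneg fun d _ => give_nonneg ρ _
  have hnogive : D v ≤ 6 → ∀ d ∈ dartsAt G v, give D ρ d = 0 := fun hv d hd =>
    h.give_eq_zero_of_le_six ρ (by rw [mem_dartsAt.1 hd]; exact hv)
  rcases h.degree_eq v with hdeg | ⟨-, -, hcard⟩
  · rw [hdeg]
    have hcases : D v = 3 ∨ D v = 4 ∨ D v = 5 ∨ D v = 6 ∨ D v = 7 ∨ D v = 8 ∨ D v = 9 ∨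
        D v = 10 ∨ D v = 11 ∨ 12 ≤ D v := by omega
    rcases hcases with hv | hv | hv | hv | hv | hv | hv | hv | hv | hv
    · have : ∀ d ∈ dartsAt G v, sides ρ d / 4 - give D ρ d + give D ρ d.symm = 1 := by
        intro d hd
        have hs : d.symm.snd = v := mem_dartsAt.1 hd
        rw [hnogive (by omega) d hd, give_three ρ (by rw [hs, hv]), sides_symm]
        ring
      rw [Finset.sum_congr rfl this, Finset.sum_const, card_dartsAt, hdeg, hv]
      norm_num
    · have h1 := h.receive_four ρ hv
      have h2 : ∑ d ∈ dartsAt G v, (give D ρ d - sides ρ d / 4) ≤ 0 :=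
        Finset.sum_nonpos fun d hd => by
          have := sides_nonneg ρ d
          rw [hnogive (by omega) d hd]; linarith
      rw [hsplit, hv]
      push_cast
      linarith
    · have h1 := h.receive_five ρ hv
      have h2 : ∑ d ∈ dartsAt G v, (sides ρ d / 4 - give D ρ d + give D ρ d.symm) =
          ∑ d ∈ dartsAt G v, (sides ρ d / 4 + give D ρ d.symm) :=
        Finset.sum_congr rfl fun d hd => by rw [hnogive (by omega) d hd]; ring
      rw [h2, hv]
      push_cast
      linarith
    · have h2 : ∑ d ∈ dartsAt G v, (give D ρ d - sides ρ d / 4) ≤ 0 :=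
        Finset.sum_nonpos fun d hd => by
          have := sides_nonneg ρ d
          rw [hnogive (by omega) d hd]; linarith
      rw [hsplit, hv]
      push_cast
      linarith
    · have h1 := h.sum_seven ρ hv
      rw [hsplit, hv]
      push_cast
      linarith
    · have h1 := h.sum_eight ρ hv
      rw [hsplit, hv]
      push_cast
      linarith
    · have h1 := h.sum_nine ρ hdeg hv
      rw [hsplit, hv]
      push_cast
      linarith
    · have h1 := h.sum_ten ρ hdeg hv
      rw [hsplit, hv]
      push_cast
      linarith
    · have h1 := h.sum_eleven ρ hdeg hv
      rw [hsplit, hv]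
      push_cast
      linarith
    · have h1 := h.sum_twelve ρ hdeg hv
      rw [hsplit]
      linarith
  -- A vertex that lost 2-neighbours sends at most 1 to each of at most deg − 8 small neighbours,
  -- which leaves at least 2.
  · have h1 := sum_le_card (D := D) ρ v
    have h2 : ((G.neighborFinset v).filter fun w => D w ≤ 5).card ≤
        ((G.neighborFinset v).filter fun w => D w ≤ 8).card :=
      Finset.card_le_card (Finset.monotone_filter_right _ fun w _ hw => by omega)
    have h3 : ((((G.neighborFinset v).filter fun w => D w ≤ 5).card : ℕ) : ℚ) + 8 ≤
        G.degree v := by exact_mod_cast (Nat.add_le_add_right h2 8).trans hcard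
    rw [hsplit]
    linarith

/-- A nonempty planar graph cannot satisfy all the local conditions. -/
theorem not_isPlanar [Nonempty V] : ¬ G.IsPlanar := by
  rintro ⟨P⟩
  obtain ⟨P⟩ := P.exists_polygonalDrawing
  obtain ⟨ρ, hρ⟩ := P.exists_rotationSystem
  have htotal := ρ.total_charge (fun v => (by norm_num : 2 ≤ 3).trans (h.three_le v)) hρ
  have hnn : 0 ≤ ∑ v, ((G.degree v : ℚ) - 6 +
      ∑ d ∈ dartsAt G v, (sides ρ d / 4 - give D ρ d + give D ρ d.symm)) :=
    Finset.sum_nonneg fun v _ => h.charge_nonneg ρ v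
  have hsymm : ∀ f : G.Dart → ℚ, ∑ d : G.Dart, f d.symm = ∑ d, f d := fun f =>
    Equiv.sum_comp G.dartReverse f
  have hfib : ∑ v, ∑ d ∈ dartsAt G v, (sides ρ d / 4 - give D ρ d + give D ρ d.symm) =
      ∑ d, (sides ρ d / 4 - give D ρ d + give D ρ d.symm) :=
    Finset.sum_fiberwise Finset.univ (fun d : G.Dart => d.fst) _
  have hsides : ∑ d, sides ρ d / 4 = (∑ d, ρ.nontri d) / 2 := by
    rw [← Finset.sum_div]
    unfold sides
    rw [Finset.sum_add_distrib, hsymm ρ.nontri]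
    ring
  -- Over all darts the amounts sent and received cancel, and the `sides / 4` add up to the corner
  -- charges, so the total is still at most −6.
  rw [Finset.sum_add_distrib, hfib, Finset.sum_add_distrib, Finset.sum_sub_distrib,
    Finset.sum_sub_distrib, hsides, hsymm (give D ρ)] at hnn
  rw [Finset.sum_sub_distrib] at htotal
  linarith

end ConfigFree

end SimpleGraph

/-! ### Deleting the 2-vertices from a graph without the configurations. -/

namespace SimpleGraph

variable {V : Type*} {G : SimpleGraph V}

/-- Induced subgraphs of planar graphs are planar. -/
theorem IsPlanar.induce (h : G.IsPlanar) (s : Set V) : (G.induce s).IsPlanar := by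
  obtain ⟨P⟩ := h
  have hmap : ∀ e : Sym2 s, e ∈ (G.induce s).edgeSet → e.map Subtype.val ∈ G.edgeSet := by
    intro e he
    induction e with
    | _ u v => exact he
  have hinj : Function.Injective (Sym2.map (Subtype.val : s → V)) :=
    Sym2.map.injective Subtype.val_injective
  exact ⟨{
    pos := fun v => P.pos v
    arc := fun e => P.arc (e.map Subtype.val)
    pos_injective := P.pos_injective.comp Subtype.val_injective
    isArc := fun u v huv => P.isArc u v huv
    vertex_on_arc := by
      intro e he w hw
      obtain ⟨w', hw', hww⟩ := Sym2.mem_map.1 (P.vertex_on_arc _ (hmap e he) w hw)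
      rwa [← Subtype.ext hww]
    arc_inter_arc := by
      intro e he f hf hef x hx
      obtain ⟨w, hwe, hwf, rfl⟩ := P.arc_inter_arc _ (hmap e he) _ (hmap f hf)
        (fun h => hef (hinj h)) x hx
      obtain ⟨a, ha, rfl⟩ := Sym2.mem_map.1 hwe
      obtain ⟨b, hb, hab⟩ := Sym2.mem_map.1 hwf
      exact ⟨a, ha, Subtype.ext hab ▸ hb, rfl⟩ }⟩

theorem exists_index {v w : V} {k : ℕ} {x : Fin k → V} (hx : Set.range x = G.neighborSet v)
    (hw : G.Adj v w) : ∃ i, x i = w := by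
  have : w ∈ Set.range x := by rw [hx]; exact hw
  exact this

theorem adj_sorted {v : V} {k : ℕ} {x : Fin k → V} (hx : Set.range x = G.neighborSet v)
    (i : Fin k) : G.Adj v (x i) := by
  have : x i ∈ G.neighborSet v := by rw [← hx]; exact ⟨i, rfl⟩
  exact this

variable [Fintype V] [DecidableRel G.Adj]

theorem IsTwoConnected.two_le_degree (h : G.IsTwoConnected) (v : V) : 2 ≤ G.degree v := by
  classical
  obtain ⟨hcard, -, hdel⟩ := h
  -- After deleting `u` the graph is connected with at least two vertices, so `v` still has a
  -- neighbour. Using this twice gives two different neighbours.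
  have key : ∀ u, u ≠ v → ∃ w, G.Adj v w ∧ w ≠ u := by
    intro u hu
    obtain ⟨w, hw⟩ : ∃ w, w ∉ ({u, v} : Finset V) := by
      by_contra hc
      push Not at hc
      have : (Finset.univ : Finset V).card ≤ ({u, v} : Finset V).card :=
        Finset.card_le_card fun x _ => hc x
      have := this.trans Finset.card_le_two
      rw [Finset.card_univ] at this
      omega
    simp only [Finset.mem_insert, Finset.mem_singleton, not_or] at hw
    have : Nontrivial {w | w ≠ u} :=
      ⟨⟨⟨v, hu.symm⟩, ⟨w, hw.1⟩, fun e => hw.2 (congrArg Subtype.val e).symm⟩⟩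
    obtain ⟨⟨x, hx⟩, hadj⟩ :=
      (hdel u).preconnected.exists_adj_of_nontrivial (⟨v, hu.symm⟩ : {w | w ≠ u})
    exact ⟨x, hadj, hx⟩
  obtain ⟨u, hu⟩ : ∃ u, u ≠ v := Fintype.exists_ne_of_one_lt_card (by omega) v
  obtain ⟨w, hw, -⟩ := key u hu
  obtain ⟨x, hx, hxw⟩ := key w hw.ne'
  rw [← card_neighborFinset_eq_degree]
  exact Finset.one_lt_card.2 ⟨w, by simpa using hw, x, by simpa using hx, hxw.symm⟩

/-- The neighbours of a vertex can be sorted by any key. -/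
theorem exists_sorted_nbrs (v : V) {k : ℕ} (hk : G.degree v = k) (key : V → ℕ) :
    ∃ x : Fin k → V, Function.Injective x ∧ Set.range x = G.neighborSet v ∧
      Monotone fun i => key (x i) := by
  classical
  have hc : Fintype.card (G.neighborSet v) = k := by rw [card_neighborSet_eq_degree, hk]
  let e : Fin k ≃ G.neighborSet v := (Fintype.equivFinOfCardEq hc).symm
  let f : Fin k → ℕ := fun i => key (e i)
  let τ := Tuple.sort f
  refine ⟨fun i => e (τ i), ?_, ?_, Tuple.monotone_sort f⟩
  · intro i j hij
    exact τ.injective (e.injective (Subtype.ext hij))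
  · ext w
    constructor
    · rintro ⟨i, rfl⟩
      exact (e (τ i)).2
    · intro hw
      exact ⟨τ.symm (e.symm ⟨w, hw⟩), by simp⟩

variable (G) in
/-- The vertices of degree at least 3. -/
abbrev core : Set V := {v | 3 ≤ G.degree v}

theorem core_card_filter [DecidableRel (G.induce G.core).Adj] [Fintype G.core]
    (v : G.core) (p : V → Prop) [DecidablePred p] :
    (((G.induce G.core).neighborFinset v).filter fun w : G.core => p w).card =
      ((G.neighborFinset v).filter fun w => 3 ≤ G.degree w ∧ p w).card := by
  refine Finset.card_bij (fun w _ => (w : V)) ?_ ?_ ?_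
  · intro w hw
    rw [Finset.mem_filter, mem_neighborFinset] at hw ⊢
    exact ⟨hw.1, w.2, hw.2⟩
  · intro w _ w' _ h
    exact Subtype.ext h
  · intro w hw
    rw [Finset.mem_filter, mem_neighborFinset] at hw
    refine ⟨⟨w, hw.2.1⟩, ?_, rfl⟩
    rw [Finset.mem_filter, mem_neighborFinset]
    exact ⟨hw.1, hw.2.2⟩

section NoConfig

variable (h2 : ∀ v, 2 ≤ G.degree v) (h1 : ¬ G.ConfigA1) (hA2 : ¬ G.ConfigA2)
  (h3 : ¬ G.ConfigA3) (h4 : ¬ G.ConfigA4)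

include h1

theorem ten_le_degree {u v : V} (huv : G.Adj u v) (hv : G.degree v = 2) : 10 ≤ G.degree u := by
  classical
  by_contra hc
  have hcard : 1 < (G.neighborFinset v).card := by
    rw [card_neighborFinset_eq_degree, hv]; norm_num
  obtain ⟨w, hw, hwu⟩ := Finset.exists_mem_ne hcard u
  rw [mem_neighborFinset] at hw
  exact h1 ⟨u, v, w, huv, hw, hwu.symm, hv, by omega⟩

include h2 h3

theorem four_le_degree {v w : V} (hv : G.degree v ≤ 8) (hvw : G.Adj v w) :
    4 ≤ G.degree w := by
  by_contra hc
  have := h2 w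
  rcases (show G.degree w = 2 ∨ G.degree w = 3 by omega) with hw | hw
  · have := ten_le_degree h1 hvw hw
    omega
  · exact h3 ⟨w, v, hw, hvw.symm, Or.inl hv⟩

include h4

/-- `ConfigA41` speaks of the two smallest degrees in a sorted list, and any two distinct neighbours
have at least their sum. The lower bound 4 on the smallest degree is automatic by `four_le_degree`.
-/
theorem four_sum {v u w : V} (hv : G.degree v = 4) (hu : G.Adj v u) (hw : G.Adj v w)
    (huw : u ≠ w) (hu7 : G.degree u ≤ 7) : 18 ≤ G.degree u + G.degree w := by
  by_contra hc
  obtain ⟨x, hinj, hrange, hmono⟩ := exists_sorted_nbrs v hv fun w => G.degree w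
  obtain ⟨i, rfl⟩ := exists_index hrange hu
  obtain ⟨j, rfl⟩ := exists_index hrange hw
  have hij : i ≠ j := fun e => huw (by rw [e])
  have h0 : ∀ i, G.degree (x 0) ≤ G.degree (x i) := fun i => hmono (Fin.zero_le i)
  have h1' : ∀ i j : Fin 4, i < j → G.degree (x 1) ≤ G.degree (x j) := fun i j hij =>
    hmono (show (1 : Fin 4) ≤ j from Fin.le_def.2 (by
      have := Fin.lt_def.1 hij
      change 1 ≤ (j : ℕ)
      omega))
  have hsum : G.degree (x 0) + G.degree (x 1) ≤ G.degree (x i) + G.degree (x j) := by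
    have := h0 i
    have := h0 j
    rcases lt_or_gt_of_ne hij with hl | hl
    · have := h1' _ _ hl; omega
    · have := h1' _ _ hl; omega
  have h4' := four_le_degree h2 h1 h3 (hv.le.trans (by norm_num)) (adj_sorted hrange 0)
  have := h0 i
  exact h4 (Or.inl ⟨v, x, hv, ⟨hinj, hrange, hmono⟩, h4', by omega, by omega⟩)

theorem five_sum {v a b c : V} (hv : G.degree v = 5) (ha : G.Adj v a) (hb : G.Adj v b)
    (hc : G.Adj v c) (hab : a ≠ b) (hac : a ≠ c) (hbc : b ≠ c) :
    19 ≤ G.degree a + G.degree b + G.degree c := by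
  by_contra hcon
  obtain ⟨x, hinj, hrange, hmono⟩ := exists_sorted_nbrs v hv fun w => G.degree w
  obtain ⟨i, rfl⟩ := exists_index hrange ha
  obtain ⟨j, rfl⟩ := exists_index hrange hb
  obtain ⟨k, rfl⟩ := exists_index hrange hc
  have hij : i ≠ j := fun e => hab (by rw [e])
  have hik : i ≠ k := fun e => hac (by rw [e])
  have hjk : j ≠ k := fun e => hbc (by rw [e])
  have key : ∀ i j k : Fin 5, i < j → j < k →
      G.degree (x 0) + G.degree (x 1) + G.degree (x 2) ≤
        G.degree (x i) + G.degree (x j) + G.degree (x k) := by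
    intro i j k hij hjk
    have e1 := Fin.lt_def.1 hij
    have e2 := Fin.lt_def.1 hjk
    have m0 : G.degree (x 0) ≤ G.degree (x i) := hmono (Fin.zero_le i)
    have m1 : G.degree (x 1) ≤ G.degree (x j) :=
      hmono (show (1 : Fin 5) ≤ j from Fin.le_def.2 (by change 1 ≤ (j : ℕ); omega))
    have m2 : G.degree (x 2) ≤ G.degree (x k) :=
      hmono (show (2 : Fin 5) ≤ k from Fin.le_def.2 (by change 2 ≤ (k : ℕ); omega))
    omega
  have hsum : G.degree (x 0) + G.degree (x 1) + G.degree (x 2) ≤ 18 := by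
    rcases lt_or_gt_of_ne hij with h | h <;> rcases lt_or_gt_of_ne hik with h' | h' <;>
      rcases lt_or_gt_of_ne hjk with h'' | h''
    · have := key _ _ _ h h''; omega
    · have := key _ _ _ h' h''; omega
    · exact absurd (h.trans h'') h'.not_gt
    · have := key _ _ _ h' h; omega
    · have := key _ _ _ h h'; omega
    · exact absurd (h'.trans h'') h.not_gt
    · have := key _ _ _ h'' h'; omega
    · have := key _ _ _ h'' h; omega
  have h4' := four_le_degree h2 h1 h3 (hv.le.trans (by norm_num)) (adj_sorted hrange 0)
  have m1 : G.degree (x 0) ≤ G.degree (x 1) :=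
    hmono (show (0 : Fin 5) ≤ 1 by decide)
  have m2 : G.degree (x 0) ≤ G.degree (x 2) :=
    hmono (show (0 : Fin 5) ≤ 2 by decide)
  exact h4 (Or.inr ⟨v, x, hv, ⟨hinj, hrange, hmono⟩, Or.inl ⟨h4', by omega, hsum⟩⟩)

omit h2 h1 h3 in
theorem five_six_seven_not_adj {v a b : V} (hv : G.degree v = 5)
    (h67 : ∀ w, G.Adj v w → G.degree w = 6 ∨ G.degree w = 7)
    (hcard : ((G.neighborFinset v).filter fun w => G.degree w = 6).card = 2)
    (ha : G.Adj v a) (hb : G.Adj v b) (ha6 : G.degree a = 6) (hb7 : G.degree b = 7) :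
    ¬ G.Adj a b := by
  classical
  intro hab
  have hne : a ≠ b := hab.ne
  -- Sorting by degree with ties broken so that `a` comes first among its equals and `b` last; this
  -- puts the adjacent pair at positions 0 and 4, as `ConfigA42` requires.
  let key : V → ℕ := fun w => 3 * G.degree w + if w = a then 0 else if w = b then 2 else 1
  have hkey : ∀ w, 3 * G.degree w ≤ key w ∧ key w ≤ 3 * G.degree w + 2 := by
    intro w
    simp only [key]
    split_ifs <;> omega
  obtain ⟨x, hinj, hrange, hmonok⟩ := exists_sorted_nbrs v hv key
  have hmono : Monotone fun i => G.degree (x i) := by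
    intro i j hij
    have e1 := hmonok hij
    have e2 := hkey (x i)
    have e3 := hkey (x j)
    simp only at e1 ⊢
    omega
  have hx : ∀ i, G.degree (x i) = 6 ∨ G.degree (x i) = 7 := fun i => h67 _ (adj_sorted hrange i)
  have hx0 : x 0 = a := by
    obtain ⟨i, hi⟩ := exists_index hrange ha
    have e1 : key (x 0) ≤ key (x i) := hmonok (Fin.zero_le i)
    by_contra hc
    have e2 : key (x i) = 18 := by simp [key, hi, ha6]
    have e3 : 3 * G.degree (x 0) + 1 ≤ key (x 0) := by
      simp only [key, if_neg hc]
      split_ifs <;> omega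
    have := hx 0
    omega
  have hx4 : x 4 = b := by
    obtain ⟨i, hi⟩ := exists_index hrange hb
    have e1 : key (x i) ≤ key (x 4) := hmonok (Fin.le_last i)
    by_contra hc
    have e2 : key (x i) = 23 := by simp [key, hi, hb7, hne.symm]
    have e3 : key (x 4) ≤ 3 * G.degree (x 4) + 1 := by
      simp only [key, if_neg hc]
      split_ifs <;> omega
    have := hx 4
    omega
  have himg : G.neighborFinset v = Finset.univ.image x := by
    ext w
    rw [mem_neighborFinset, Finset.mem_image]
    constructor
    · intro hw
      obtain ⟨i, hi⟩ := exists_index hrange hw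
      exact ⟨i, Finset.mem_univ _, hi⟩
    · rintro ⟨i, -, rfl⟩
      exact adj_sorted hrange i
  rw [himg, Finset.card_filter, Finset.sum_image fun i _ j _ hij => hinj hij,
    Fin.sum_univ_five] at hcard
  have m01 : G.degree (x 0) ≤ G.degree (x 1) :=
    hmono (show (0 : Fin 5) ≤ 1 by decide)
  have m12 : G.degree (x 1) ≤ G.degree (x 2) :=
    hmono (show (1 : Fin 5) ≤ 2 by decide)
  have m23 : G.degree (x 2) ≤ G.degree (x 3) :=
    hmono (show (2 : Fin 5) ≤ 3 by decide)
  have m34 : G.degree (x 3) ≤ G.degree (x 4) :=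
    hmono (show (3 : Fin 5) ≤ 4 by decide)
  have d0 : G.degree (x 0) = 6 := by rw [hx0, ha6]
  have d4 : G.degree (x 4) = 7 := by rw [hx4, hb7]
  have d1 := hx 1
  have d2 := hx 2
  have d3 := hx 3
  have hd : G.degree (x 1) = 6 ∧ G.degree (x 2) = 7 ∧ G.degree (x 3) = 7 := by
    split_ifs at hcard <;> omega
  exact h4 (Or.inr ⟨v, x, hv, ⟨hinj, hrange, hmono⟩,
    Or.inr ⟨d0, hd.1, hd.2.1, hd.2.2, d4, by rw [hx0, hx4]; exact hab⟩⟩)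

include hA2

/-- Only `degree_eq` uses the absence of `ConfigA2`. The other conditions are stated with degrees in
`G`, so they follow from the absence of the remaining configurations in `G`. -/
theorem configFree_core [DecidableRel (G.induce G.core).Adj] [Fintype G.core] :
    ConfigFree (G.induce G.core) fun v => G.degree v := by
  classical
  have hdeg : ∀ v : G.core, (G.induce G.core).degree v + G.numNbrs 2 v = G.degree v := by
    intro v
    have h := core_card_filter v fun _ => True
    simp only [Finset.filter_true, and_true] at h
    rw [card_neighborFinset_eq_degree] at h
    rw [h, ← card_neighborFinset_eq_degree G v, numNbrs,
      ← Finset.card_filter_add_card_filter_not (s := G.neighborFinset v)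
        fun w => 3 ≤ G.degree w]
    congr 2
    refine Finset.filter_congr fun w _ => ?_
    have := h2 w
    omega
  have hsmall : ∀ v : G.core,
      (((G.induce G.core).neighborFinset v).filter fun w : G.core => G.degree w ≤ 8).card +
        G.numNbrs 2 v = G.numNbrsLE 8 v := by
    intro v
    rw [core_card_filter v fun w => G.degree w ≤ 8, numNbrs, numNbrsLE,
      ← Finset.card_filter_add_card_filter_not
        (s := (G.neighborFinset v).filter fun w => G.degree w ≤ 8) fun w => 3 ≤ G.degree w,
      Finset.filter_filter, Finset.filter_filter]
    congr 2
    · exact Finset.filter_congr fun w _ => and_comm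
    · refine Finset.filter_congr fun w _ => ?_
      have := h2 w
      omega
  have haffected : ∀ v : G.core, (G.induce G.core).degree v = G.degree v ∨
      9 ≤ (G.induce G.core).degree v ∧ 9 ≤ G.degree v ∧
      (((G.induce G.core).neighborFinset v).filter fun w : G.core => G.degree w ≤ 8).card + 8 ≤
        (G.induce G.core).degree v := by
    intro v
    have e1 := hdeg v
    have e2 := hsmall v
    by_cases h0 : G.numNbrs 2 (v : V) = 0
    · left; omega
    · right
      obtain ⟨x, hx⟩ := Finset.card_pos.1 (Nat.pos_of_ne_zero h0)
      rw [Finset.mem_filter, mem_neighborFinset] at hx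
      have h10 := ten_le_degree h1 hx.1 hx.2
      -- Write d for the degree, n₂ and n₈ for the two counts. Then n₈ ≤ d − 9, or n₈ = d − 8 and n₂
      -- ≤ d − 10. In the core the degree is d − n₂ and n₈ − n₂ neighbours are small, so in both
      -- cases at least eight are large and the degree is at least 9.
      have hno : ¬ ((G.degree (v : V) : ℤ) - 8 ≤ G.numNbrsLE 8 (v : V) ∧
          ((G.degree (v : V) : ℤ) - 7 ≤ G.numNbrsLE 8 (v : V) ∨
          ((G.numNbrsLE 8 (v : V) : ℤ) = (G.degree (v : V) : ℤ) - 8 ∧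
            (G.degree (v : V) : ℤ) - 9 ≤ G.numNbrs 2 (v : V)))) := fun h =>
        hA2 ⟨v, Nat.one_le_iff_ne_zero.2 h0, h⟩
      omega
  refine
    { three_le := ?_
      degree_eq := haffected
      three_adj := ?_
      three_nine := ?_
      three_ten := ?_
      four := ?_
      five := ?_
      five_six_seven := ?_ }
  · intro v
    have hv : 3 ≤ G.degree (v : V) := v.2
    rcases haffected v with h | h <;> omega
  · intro u v hu huv
    by_contra hc
    exact h3 ⟨u, v, hu, huv, Or.inl (by omega)⟩
  · intro u v w hu hv huv huw hvw
    exact h3 ⟨u, v, hu, huv, Or.inr (Or.inl ⟨hv, w, huw, hvw⟩)⟩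
  · intro u v w x hu hv huv hwx huw hvw hux hvx
    by_contra hc
    refine h3 ⟨u, v, hu, huv, Or.inr (Or.inr ⟨hv, ?_, w, x, fun e => hwx (Subtype.ext e),
      ⟨huw, hvw⟩, hux, hvx⟩)⟩
    rw [core_card_filter v fun w => G.degree w ≤ 5] at hc
    refine (Nat.succ_le_of_lt (not_le.1 hc)).trans (Finset.card_le_card ?_)
    exact Finset.monotone_filter_right _ fun w _ hw => hw.2
  · intro v u w hv hu hw huw hu7
    exact four_sum h2 h1 h3 h4 hv hu hw (fun e => huw (Subtype.ext e)) hu7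
  · intro v x y z hv hx hy hz hxy hxz hyz
    exact five_sum h2 h1 h3 h4 hv hx hy hz (fun e => hxy (Subtype.ext e))
      (fun e => hxz (Subtype.ext e)) (fun e => hyz (Subtype.ext e))
  · intro v hv h67 hcard x y hx hy hx6 hy7
    have hcore : ∀ w, G.Adj v w → 3 ≤ G.degree w := fun w hw => by
      have := four_le_degree h2 h1 h3 (hv.le.trans (by norm_num)) hw
      omega
    refine five_six_seven_not_adj h4 hv (fun w hw => h67 ⟨w, hcore w hw⟩ hw) ?_ hx hy
      hx6 hy7
    rw [core_card_filter v fun w => G.degree w = 6] at hcard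
    rw [← hcard]
    congr 1
    refine Finset.filter_congr fun w hw => ?_
    have := hcore w ((mem_neighborFinset _ _ _).1 hw)
    omega

end NoConfig

end SimpleGraph

theorem lemma1 {V : Type*} [Fintype V] (G : SimpleGraph V) [DecidableRel G.Adj]
    (hconn : G.IsTwoConnected) (hplanar : G.IsPlanar) (hdeg : 5 ≤ G.maxDegree) :
    G.ConfigA1 ∨ G.ConfigA2 ∨ G.ConfigA3 ∨ G.ConfigA4 := by
  classical
  by_contra hcon
  rw [not_or, not_or, not_or] at hcon
  obtain ⟨h1, h2, h3, h4⟩ := hcon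
  have hne : Nonempty V := hconn.2.1.nonempty
  obtain ⟨v, hv⟩ := G.exists_maximal_degree_vertex
  -- The bound on the maximum degree serves only to provide a vertex that survives the deletion;
  -- degree 3 would suffice.
  have : Nonempty G.core := ⟨⟨v, by change 3 ≤ G.degree v; omega⟩⟩
  exact (SimpleGraph.configFree_core hconn.two_le_degree h1 h2 h3 h4).not_isPlanar
    (hplanar.induce _)
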